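/- Let $(V,\|\cdot\|)$ be a Minkowski space of dimension $n$: a real normed space of dimension $n$ whose norm is smooth away from $0$ and whose unit sphere has only positive principal curvatures for any auxiliary Euclidean metric (equivalently, the Hessian of $\tfrac12\|\cdot\|^2$ is positive definite at every nonzero vector). Let $B^*$ and $S^*$ be the unit ball and the unit sphere of the dual norm on $V^*$, let $1\le k\le n$, let $\Lambda^k_sV\subset\Lambda^kV$ be the cone of simple $k$-vectors, and let $\epsilon_k$ be the volume of the Euclidean unit ball of dimension $k$. For a nonzero $a=v_1\wedge\dots\wedge v_k\in\Lambda^k_sV$ let $\langle a\rangle=\mathrm{span}(v_1,\dots,v_k)$, oriented by $a$, and let $P_a\colon V^*\to\langle a\rangle^*$ be the restriction of covectors. Regarding $k$-vectors as $k$-forms on $V^*$ by $(v_1\wedge\dots\wedge v_k)(p_1,\dots,p_k)=\det(p_i(v_j))$, the Holmes--Thompson density is $$\phi(a)=\frac1{\epsilon_k}\int_{P_a(B^*)}a,\qquad \phi(0)=0 .$$ Let $\Sigma_a\subset S^*$ be the set of points at which the derivative of $P_a|_{S^*}\colon S^*\to\langle a\rangle^*$ is not onto; it is a $(k-1)$-dimensional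 submanifold of $S^*$ which $P_a$ maps diffeomorphically onto $\partial P_a(B^*)$, and it carries the orientation of $\partial P_a(B^*)$. The Busemann form $\beta_a\in\Lambda^kV^*\cong(\Lambda^kV)^*$ is $$\beta_a(b)=\frac1{k\,\epsilon_k}\int_{\Sigma_a} i_\chi b,\qquad b\in\Lambda^kV,$$ where $\chi(p)=p$ is the Euler field on $V^*$. Then $\phi$ is a $k$-density on $V$, that is, $\phi\colon\Lambda^k_sV\to[0,\infty)$ is smooth on $\Lambda^k_sV\setminus\{0\}$, vanishes only at $0$, and satisfies $\phi(ta)=|t|\phi(a)$ for all $t\in\mathbb R$. Moreover the map $$\mathcal L\colon \Lambda^k_sV\to\Lambda^kV^*,\qquad \mathcal L(a)=\phi(a)\,\beta_a\quad(\mathcal L(0)=0),$$ is a Legendre map for $\phi$: it is smooth on $\Lambda^k_sV\setminus\{0\}$, and 1. $\mathcal L(ta)=t\,\mathcal L(a)$ for all $a\in\Lambda^k_sV$ and $t\in\mathbb R$; 2. $\mathcal L(a)(a)=\phi(a)^2$ for all $a\in\Lambda^k_sV$; 3. for every $a$ in the unit sphere $S_\phi=\{a\in\Lambda^k_sV:\phi(a)=1\}$,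 the form $\mathcal L(a)$ vanishes on the tangent space $T_aS_\phi\subset\Lambda^kV$. -/

import Mathlib

set_option linter.unusedSectionVars false

open MeasureTheory Set Metric
open scoped ContDiff

namespace HolmesThompson

/-! ### Minkowski spaces -/

/-- A Minkowski space: the norm is smooth away from the origin and the derivative of its Legendre
map `v ↦ d(‖·‖² / 2)_v` is positive definite at every nonzero vector. Equivalently, the unit
sphere is smooth and all its principal curvatures, for any auxiliary Euclidean metric, are
positive. -/
structure IsMinkowski (V : Type*) [NormedAddCommGroup V] [NormedSpace ℝ V] : Prop where
  smooth : ContDiffOn ℝ ∞ (fun x : V => ‖x‖) {0}ᶜ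
  posDef : ∀ v : V, v ≠ 0 → ∀ w : V, w ≠ 0 →
    0 < fderiv ℝ (fun x : V => fderiv ℝ (fun y : V => ‖y‖ ^ 2 / 2) x) v w w

/-! ### Smooth maps on, and tangent vectors to, subsets of normed spaces -/

/-- `f` is smooth on the subset `s`: around every point of `s` it extends to a smooth map on an
open set of the ambient space. -/
def SmoothOnSubset {E F : Type*} [NormedAddCommGroup E] [NormedSpace ℝ E]
    [NormedAddCommGroup F] [NormedSpace ℝ F] (f : E → F) (s : Set E) : Prop :=
  ∀ x ∈ s, ∃ U : Set E, IsOpen U ∧ x ∈ U ∧ ∃ g : E → F, ContDiffOn ℝ ∞ g U ∧ EqOn g f (U ∩ s)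

/-- The tangent space at `x` of a submanifold `S` of a normed space: the velocities at `x` of the
smooth curves that stay in `S`. -/
def tangentVectors {E : Type*} [NormedAddCommGroup E] [NormedSpace ℝ E] (S : Set E) (x : E) :
    Set E :=
  {w | ∃ γ : ℝ → E, ContDiff ℝ ∞ γ ∧ (∀ t, γ t ∈ S) ∧ γ 0 = x ∧ deriv γ 0 = w}

/-! ### `k`-vectors, densities and Legendre maps -/

section KVectors

variable {V : Type*} [NormedAddCommGroup V] [NormedSpace ℝ V] [FiniteDimensional ℝ V]

/-- An auxiliary norm on the space of `k`-vectors (the sup norm of the coordinates in a basis).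
It serves only to speak of smooth maps; as the space is finite dimensional, the choice of the norm
is irrelevant. -/
noncomputable instance kVectorNorm (k : ℕ) : NormedAddCommGroup (⋀[ℝ]^k V) :=
  NormedAddCommGroup.induced (⋀[ℝ]^k V) _
    (Module.finBasis ℝ (⋀[ℝ]^k V)).equivFun.toLinearMap
    (Module.finBasis ℝ (⋀[ℝ]^k V)).equivFun.injective

noncomputable instance kVectorNormedSpace (k : ℕ) : NormedSpace ℝ (⋀[ℝ]^k V) :=
  NormedSpace.induced ℝ (⋀[ℝ]^k V) _ (Module.finBasis ℝ (⋀[ℝ]^k V)).equivFun.toLinearMap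

/-- The Grassmann cone: the simple `k`-vectors `v₁ ∧ ⋯ ∧ vₖ` (with `0`). -/
def grassmannCone (k : ℕ) (V : Type*) [NormedAddCommGroup V] [NormedSpace ℝ V] :
    Set (⋀[ℝ]^k V) :=
  range (exteriorPower.ιMulti ℝ k : (Fin k → V) → ⋀[ℝ]^k V)

/-- `φ` is a `k`-density on `V`; only its values on the Grassmann cone matter. -/
structure IsDensity {k : ℕ} (φ : ⋀[ℝ]^k V → ℝ) : Prop where
  smooth : SmoothOnSubset φ (grassmannCone k V \ {0})
  nonneg : ∀ a ∈ grassmannCone k V, 0 ≤ φ a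
  eq_zero_iff : ∀ a ∈ grassmannCone k V, (φ a = 0 ↔ a = 0)
  homogeneous : ∀ a ∈ grassmannCone k V, ∀ t : ℝ, φ (t • a) = |t| * φ a

/-- The unit sphere `S_φ` of a density: the simple `k`-vectors with `φ = 1`. -/
def unitSphere {k : ℕ} (φ : ⋀[ℝ]^k V → ℝ) : Set (⋀[ℝ]^k V) :=
  {a | a ∈ grassmannCone k V ∧ φ a = 1}

/-- `L` is a Legendre map for the density `φ`. The space `Λᵏ V*` of `k`-forms on `V` is the dual
of the space of `k`-vectors; only the values of `L` on the Grassmann cone matter. -/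
structure IsLegendreMap {k : ℕ} (φ : ⋀[ℝ]^k V → ℝ) (L : ⋀[ℝ]^k V → StrongDual ℝ (⋀[ℝ]^k V)) :
    Prop where
  smooth : SmoothOnSubset L (grassmannCone k V \ {0})
  homogeneous : ∀ a ∈ grassmannCone k V, ∀ t : ℝ, L (t • a) = t • L a
  apply_self : ∀ a ∈ grassmannCone k V, L a a = φ a ^ 2
  vanish : ∀ a ∈ unitSphere φ, ∀ b ∈ tangentVectors (unitSphere φ) a, L a b = 0

/-! ### The Holmes–Thompson density -/

/-- Vectors `v₁, …, vₖ` with `v₁ ∧ ⋯ ∧ vₖ = a`, for a simple `k`-vector `a`. If `a ≠ 0`, they form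
a positively oriented basis of the oriented `k`-plane `⟨a⟩`. -/
noncomputable def frame {k : ℕ} (a : ⋀[ℝ]^k V) : Fin k → V :=
  Function.invFun (exteriorPower.ιMulti ℝ k : (Fin k → V) → ⋀[ℝ]^k V) a

/-- The projection `P_a : V* → ⟨a⟩*` (restriction of a covector to the plane `⟨a⟩` spanned by
`v = frame a`), where `⟨a⟩*` is identified with `ℝᵏ` through the basis dual to `v`:
`p ↦ (p v₁, …, p vₖ)`. In these coordinates `a`, as a `k`-form on `⟨a⟩*`, is the standard volume
form `dx₁ ∧ ⋯ ∧ dxₖ`, and the orientation of `⟨a⟩*` is the standard one. -/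
noncomputable def proj {k : ℕ} (v : Fin k → V) : StrongDual ℝ V →L[ℝ] EuclideanSpace ℝ (Fin k) :=
  LinearMap.toContinuousLinearMap
    { toFun := fun p => WithLp.toLp 2 (fun i => p (v i))
      map_add' := fun p q => by ext i; simp
      map_smul' := fun c p => by ext i; simp }

/-- `ε_k`, the volume of the Euclidean unit ball of dimension `k`. -/
noncomputable def ballVolume (k : ℕ) : ℝ :=
  volume.real (ball (0 : EuclideanSpace ℝ (Fin k)) 1)

/-- The Holmes–Thompson density `φ(a) = (1 / ε_k) ∫_{P_a(B*)} a`. -/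
noncomputable def density {k : ℕ} (a : ⋀[ℝ]^k V) : ℝ :=
  1 / ballVolume k * volume.real (proj (frame a) '' closedBall (0 : StrongDual ℝ V) 1)

end KVectors

/-! ### Integration of differential forms over submanifolds diffeomorphic to a sphere -/

section Integration

variable {m : ℕ} {W : Type*} [NormedAddCommGroup W] [NormedSpace ℝ W]

/-- The value of an `m`-covector `η`, at the point `u` of the unit sphere of `ℝ^{m+1}`, on any
basis `t₁, …, tₘ` of `T_u Sᵐ = u^⊥` such that `(u, t₁, …, tₘ)` is a positively oriented
orthonormal basis of `ℝ^{m+1}`. This is the value of `u^♭ ∧ η` on the standard basis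
`e₀, …, eₘ`, i.e. `∑ᵢ (-1)ⁱ uᵢ η(e₀, …, êᵢ, …, eₘ)`. -/
noncomputable def sphereCoeff (η : EuclideanSpace ℝ (Fin (m + 1)) [⋀^Fin m]→ₗ[ℝ] ℝ)
    (u : EuclideanSpace ℝ (Fin (m + 1))) : ℝ :=
  ∑ i : Fin (m + 1), (-1) ^ (i : ℕ) * u i *
    η (fun j => EuclideanSpace.single (i.succAbove j) (1 : ℝ))

/-- The pullback by `f` of a differential `m`-form `θ` on `W`. -/
noncomputable def pullback (f : EuclideanSpace ℝ (Fin (m + 1)) → W) (θ : W → W [⋀^Fin m]→ₗ[ℝ] ℝ)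
    (u : EuclideanSpace ℝ (Fin (m + 1))) : EuclideanSpace ℝ (Fin (m + 1)) [⋀^Fin m]→ₗ[ℝ] ℝ :=
  (θ (f u)).compLinearMap (fderiv ℝ f u : EuclideanSpace ℝ (Fin (m + 1)) →ₗ[ℝ] W)

/-- The integral of an `m`-form over the unit sphere of `ℝ^{m+1}`, oriented as the boundary of the
unit ball; for `m = 0` it is the difference of the values at `1` and at `-1`. -/
noncomputable def sphereIntegral
    (η : EuclideanSpace ℝ (Fin (m + 1)) →
      EuclideanSpace ℝ (Fin (m + 1)) [⋀^Fin m]→ₗ[ℝ] ℝ) : ℝ :=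
  ∫ u : sphere (0 : EuclideanSpace ℝ (Fin (m + 1))) 1, sphereCoeff (η u) u
    ∂(volume : Measure (EuclideanSpace ℝ (Fin (m + 1)))).toSphere

/-- `f` (restricted to the unit sphere `Sᵐ`) is an orientation preserving diffeomorphism of `Sᵐ`
onto `M`, where the `m`-dimensional submanifold `M` of `W` is oriented by the `m`-form `α`: it is a
smooth bijection and the pullback of `α` is a positive volume form (in particular, `f` is an
immersion of the sphere). A smooth map on the sphere is written as a map which is smooth on
`ℝ^{m+1} ∖ {0}`. -/
structure IsOrientedParam (M : Set W) (α : W → W [⋀^Fin m]→ₗ[ℝ] ℝ)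
    (f : EuclideanSpace ℝ (Fin (m + 1)) → W) : Prop where
  smooth : ContDiffOn ℝ ∞ f {0}ᶜ
  bijOn : BijOn f (sphere 0 1) M
  oriented : ∀ u ∈ sphere (0 : EuclideanSpace ℝ (Fin (m + 1))) 1,
    0 < sphereCoeff (pullback f α u) u

open Classical in
/-- The integral `∫_M θ` of an `m`-form `θ` over an `m`-dimensional submanifold `M` of `W`
diffeomorphic to the sphere `Sᵐ` and oriented by the `m`-form `α`, computed in an oriented
parametrization by the sphere (it does not depend on the parametrization). -/
noncomputable def formIntegral (M : Set W) (α θ : W → W [⋀^Fin m]→ₗ[ℝ] ℝ) : ℝ :=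
  if h : ∃ f : EuclideanSpace ℝ (Fin (m + 1)) → W, IsOrientedParam M α f then
    sphereIntegral (pullback h.choose θ)
  else 0

end Integration

/-! ### The Busemann form -/

section Busemann

variable {V : Type*} [NormedAddCommGroup V] [NormedSpace ℝ V] [FiniteDimensional ℝ V]

/-- A `k`-vector `b` of `V` as a (constant) `k`-form on `V*`:
`(v₁ ∧ ⋯ ∧ vₖ)(p₁, …, pₖ) = det (pᵢ vⱼ)`. -/
noncomputable def toForm {k : ℕ} (b : ⋀[ℝ]^k V) : StrongDual ℝ V [⋀^Fin k]→ₗ[ℝ] ℝ :=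
  ((LinearMap.applyₗ b ∘ₗ exteriorPower.pairingDual ℝ V k).compAlternatingMap
    (exteriorPower.ιMulti ℝ k)).compLinearMap (ContinuousLinearMap.coeLM ℝ)

/-- The contraction `i_χ b` of the form `b` on `V*` with the Euler field `χ(p) = p`. -/
noncomputable def eulerContraction {m : ℕ} (b : ⋀[ℝ]^(m + 1) V) (p : StrongDual ℝ V) :
    StrongDual ℝ V [⋀^Fin m]→ₗ[ℝ] ℝ :=
  (toForm b).curryLeft p

/-- `Σ_a`: the singular points of the restriction of `P_a` to the dual unit sphere `S*`, i.e. the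
points `p ∈ S*` at which the derivative `T_p S* → ⟨a⟩*` of the restriction is not onto. -/
def singularLocus {k : ℕ} (a : ⋀[ℝ]^k V) : Set (StrongDual ℝ V) :=
  {p | p ∈ sphere (0 : StrongDual ℝ V) 1 ∧
    proj (frame a) '' tangentVectors (sphere (0 : StrongDual ℝ V) 1) p ≠ univ}

/-- The value `β_a(b) = (1 / (k ε_k)) ∫_{Σ_a} i_χ b` for `k = m + 1`. The orientation of `Σ_a` is
the one for which the diffeomorphism `P_a : Σ_a → ∂P_a(B*)` preserves orientations: a basis `q` of
`T_p Σ_a` is positive if `(P_a p, P_a q₁, …, P_a qₘ)` is a positive basis of `⟨a⟩*`, that is, if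
`i_χ a` is positive on `q`. -/
noncomputable def busemannValue {m : ℕ} (a b : ⋀[ℝ]^(m + 1) V) : ℝ :=
  1 / (((m + 1 : ℕ) : ℝ) * ballVolume (m + 1)) *
    formIntegral (singularLocus a) (eulerContraction a) (eulerContraction b)

theorem toForm_ιMulti {k : ℕ} (v : Fin k → V) (p : Fin k → StrongDual ℝ V) :
    toForm (exteriorPower.ιMulti ℝ k v) p = Matrix.det (Matrix.of fun i j => p j (v i)) := by
  simp [toForm]

theorem toForm_add {k : ℕ} (b c : ⋀[ℝ]^k V) : toForm (b + c) = toForm b + toForm c := by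
  ext p; simp [toForm]

theorem toForm_smul {k : ℕ} (r : ℝ) (b : ⋀[ℝ]^k V) : toForm (r • b) = r • toForm b := by
  ext p; simp [toForm]

theorem continuous_toForm {k : ℕ} (b : ⋀[ℝ]^k V) :
    Continuous fun p : Fin k → StrongDual ℝ V => toForm b p := by
  have hb : b ∈ Submodule.span ℝ (range (exteriorPower.ιMulti ℝ k : (Fin k → V) → ⋀[ℝ]^k V)) := by
    rw [exteriorPower.ιMulti_span]; trivial
  induction hb using Submodule.span_induction with
  | mem x hx =>
    obtain ⟨v, rfl⟩ := hx
    simp only [toForm_ιMulti]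
    refine Continuous.matrix_det (continuous_matrix fun i j => ?_)
    simp only [Matrix.of_apply]
    fun_prop
  | zero =>
    have h0 : toForm (0 : ⋀[ℝ]^k V) = 0 := by ext p; simp [toForm]
    simp only [h0]
    exact continuous_const
  | add x y _ _ hx hy =>
    simp only [toForm_add, AlternatingMap.add_apply]
    exact hx.add hy
  | smul r x _ hx => simpa [toForm_smul] using hx.const_mul r

theorem integrable_sphereCoeff {m : ℕ} {f : EuclideanSpace ℝ (Fin (m + 1)) → StrongDual ℝ V}
    (hf : ContDiffOn ℝ ∞ f {0}ᶜ) (b : ⋀[ℝ]^(m + 1) V) :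
    Integrable (fun u : sphere (0 : EuclideanSpace ℝ (Fin (m + 1))) 1 =>
      sphereCoeff (pullback f (eulerContraction b) u) u)
      (volume : Measure (EuclideanSpace ℝ (Fin (m + 1)))).toSphere := by
  have hsub : ∀ u : sphere (0 : EuclideanSpace ℝ (Fin (m + 1))) 1,
      (u : EuclideanSpace ℝ (Fin (m + 1))) ∈ ({0}ᶜ : Set (EuclideanSpace ℝ (Fin (m + 1)))) :=
    fun u => ne_zero_of_mem_unit_sphere u
  have h1 : Continuous fun u : sphere (0 : EuclideanSpace ℝ (Fin (m + 1))) 1 => f u :=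
    hf.continuousOn.comp_continuous continuous_subtype_val hsub
  have h2 : Continuous fun u : sphere (0 : EuclideanSpace ℝ (Fin (m + 1))) 1 => fderiv ℝ f u :=
    (hf.continuousOn_fderiv_of_isOpen isOpen_compl_singleton (by simp)).comp_continuous
      continuous_subtype_val hsub
  have h3 : Continuous fun u : sphere (0 : EuclideanSpace ℝ (Fin (m + 1))) 1 =>
      sphereCoeff (pullback f (eulerContraction b) u) u := by
    unfold sphereCoeff
    refine continuous_finsetSum _ fun i _ => Continuous.mul (by fun_prop) ?_
    simp only [pullback, eulerContraction, AlternatingMap.compLinearMap_apply,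
      AlternatingMap.curryLeft_apply_apply]
    refine (continuous_toForm b).comp (continuous_pi fun j => ?_)
    refine Fin.cases ?_ (fun j => ?_) j
    · simpa using h1
    · simpa using h2.clm_apply continuous_const
  exact h3.integrable_of_hasCompactSupport (HasCompactSupport.of_compactSpace _)

theorem sphereCoeff_pullback_add {m : ℕ}
    (f : EuclideanSpace ℝ (Fin (m + 1)) → StrongDual ℝ V) (b c : ⋀[ℝ]^(m + 1) V)
    (u : EuclideanSpace ℝ (Fin (m + 1))) :
    sphereCoeff (pullback f (eulerContraction (b + c)) u) u =
      sphereCoeff (pullback f (eulerContraction b) u) u +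
        sphereCoeff (pullback f (eulerContraction c) u) u := by
  simp [sphereCoeff, pullback, eulerContraction, toForm_add, mul_add, Finset.sum_add_distrib]

theorem sphereCoeff_pullback_smul {m : ℕ}
    (f : EuclideanSpace ℝ (Fin (m + 1)) → StrongDual ℝ V) (r : ℝ) (b : ⋀[ℝ]^(m + 1) V)
    (u : EuclideanSpace ℝ (Fin (m + 1))) :
    sphereCoeff (pullback f (eulerContraction (r • b)) u) u =
      r * sphereCoeff (pullback f (eulerContraction b) u) u := by
  simp only [sphereCoeff, pullback, eulerContraction, toForm_smul, Finset.mul_sum,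
    AlternatingMap.compLinearMap_apply, AlternatingMap.curryLeft_apply_apply,
    AlternatingMap.smul_apply, smul_eq_mul]
  exact Finset.sum_congr rfl fun i _ => by ring

theorem busemannValue_add {m : ℕ} (a b c : ⋀[ℝ]^(m + 1) V) :
    busemannValue a (b + c) = busemannValue a b + busemannValue a c := by
  unfold busemannValue formIntegral
  split_ifs with h
  · simp only [sphereIntegral, sphereCoeff_pullback_add]
    rw [integral_add (integrable_sphereCoeff h.choose_spec.smooth b)
      (integrable_sphereCoeff h.choose_spec.smooth c), mul_add]
  · simp

theorem busemannValue_smul {m : ℕ} (a : ⋀[ℝ]^(m + 1) V) (r : ℝ) (b : ⋀[ℝ]^(m + 1) V) :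
    busemannValue a (r • b) = r * busemannValue a b := by
  unfold busemannValue formIntegral
  split_ifs with h
  · simp only [sphereIntegral, sphereCoeff_pullback_smul]
    rw [integral_const_mul]
    ring
  · simp

/-- The Busemann form `β_a ∈ Λᵏ V*` with `k = m + 1`, as a linear form `b ↦ β_a(b)` on
`k`-vectors. -/
noncomputable def busemannForm {m : ℕ} (a : ⋀[ℝ]^(m + 1) V) : StrongDual ℝ (⋀[ℝ]^(m + 1) V) :=
  LinearMap.toContinuousLinearMap
    { toFun := busemannValue a
      map_add' := busemannValue_add a
      map_smul' := busemannValue_smul a }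

end Busemann

end HolmesThompson

/-! Let ℓ be the Legendre map `x ↦ d(‖·‖² / 2)_x`. It is a norm-preserving bijection `V → V*`,
homogeneous of degree one, and its derivative off the origin, the Hessian, is symmetric and positive
definite. The tangent space of `S*` at `ℓ(x)` is the annihilator of `x`, so `P_a` restricted to `S*`
is singular at `ℓ(x)` exactly when `x ∈ ⟨a⟩`: thus `Σ_a` is the image under ℓ of the unit sphere of
`⟨a⟩` (`singularLocus_eq`). Coning from the origin turns `(1/k) ∫_{Σ_a} i_χ b` into the integral of
`b` over the image of the unit ball of `⟨a⟩` (`sphereIntegral_eq`), written in a frame as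
`busemannIntegral`.

The core is a local calibration argument. For a frame `w` close to a frame `v` of `a`, with wedge
`b`, the map `P_b ∘ ℓ` is still injective on `⟨a⟩`, by strong monotonicity of ℓ, and sends the unit
ball of `⟨a⟩` into `P_b(B*)`. As `β_a(b)` is, up to `1/ε_k`, the integral of the Jacobian of this
map, `β_a(b) ≤ φ(b)` (`eventually_busemannIntegral_le`). For `b = a` the Jacobian is positive and
the image is `P_a(B*)` up to a point, so `β_a(a) = φ(a)` (`busemannIntegral_self`). This gives
`L(a)(a) = φ(a)²`; and along a curve in `S_φ` through `a` the form `β_a` has a local maximum at `a`,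
so it kills the velocity.

Homogeneity comes from comparing frames of proportional simple `k`-vectors, which differ by a matrix
of known determinant. For smoothness, polar coordinates write `β` as an integral over a fixed sphere
with integrand smooth in the frame, and frames can be chosen smoothly near a given simple
`k`-vector; `φ(a) = β_a(a)` is then smooth as well. -/

namespace HolmesThompson

/-! ### The Legendre map of a Minkowski space -/

section LegendreMap

variable {V : Type*} [NormedAddCommGroup V] [NormedSpace ℝ V]

/-- The Legendre map `x ↦ d(‖·‖² / 2)_x` of a normed space. -/
noncomputable def legendre (x : V) : StrongDual ℝ V :=
  fderiv ℝ (fun y : V => ‖y‖ ^ 2 / 2) x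

/-- The Hessian of `‖·‖² / 2`. -/
noncomputable def hessian (x : V) : V →L[ℝ] StrongDual ℝ V :=
  fderiv ℝ (legendre : V → StrongDual ℝ V) x

variable (hV : IsMinkowski V)
include hV

theorem IsMinkowski.contDiffAt_norm {x : V} (hx : x ≠ 0) : ContDiffAt ℝ ∞ (fun y : V => ‖y‖) x :=
  hV.smooth.contDiffAt (isOpen_compl_singleton.mem_nhds hx)

theorem IsMinkowski.differentiableAt_norm {x : V} (hx : x ≠ 0) :
    DifferentiableAt ℝ (fun y : V => ‖y‖) x :=
  (hV.contDiffAt_norm hx).differentiableAt (by simp)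

theorem IsMinkowski.legendre_eq {x : V} (hx : x ≠ 0) :
    legendre x = ‖x‖ • fderiv ℝ (fun y : V => ‖y‖) x := by
  have h := ((hV.differentiableAt_norm hx).hasFDerivAt.pow 2).mul_const (1 / 2 : ℝ)
  have h2 : HasFDerivAt (fun y : V => ‖y‖ ^ 2 / 2) (‖x‖ • fderiv ℝ (fun y : V => ‖y‖) x) x := by
    refine (h.congr_fderiv ?_).congr_of_eventuallyEq (Filter.Eventually.of_forall fun y => ?_)
    · ext w; simp; ring
    · simp; ring
  exact h2.fderiv

omit hV in
theorem hasFDerivAt_norm_sq_zero : HasFDerivAt (fun y : V => ‖y‖ ^ 2 / 2) (0 : StrongDual ℝ V) 0 := by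
  rw [hasFDerivAt_iff_isLittleO_nhds_zero]
  have : (fun h : V => ‖(0 : V) + h‖ ^ 2 / 2 - ‖(0 : V)‖ ^ 2 / 2 - (0 : V →L[ℝ] ℝ) h) =
      fun h : V => (1 / 2 : ℝ) * ‖h‖ ^ 2 := by
    ext h; simp; ring
  rw [this]
  refine Asymptotics.IsLittleO.const_mul_left ?_ _
  simpa using (Asymptotics.isLittleO_norm_pow_id one_lt_two : (fun x : V => ‖x‖ ^ 2) =o[_] id)

omit hV in
theorem legendre_zero : legendre (0 : V) = 0 := hasFDerivAt_norm_sq_zero.fderiv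

theorem IsMinkowski.hasFDerivAt_norm_sq (x : V) :
    HasFDerivAt (fun y : V => ‖y‖ ^ 2 / 2) (legendre x) x := by
  rcases eq_or_ne x 0 with rfl | hx
  · rw [legendre_zero]; exact hasFDerivAt_norm_sq_zero
  · exact ((((hV.contDiffAt_norm hx).pow 2).div_const 2).differentiableAt (by simp)).hasFDerivAt

/-- The derivative of the norm is homogeneous of degree zero up to the sign of `t`, and the factor
`‖t • x‖` supplies `|t|`; negative `t` is allowed because a norm is even. -/
theorem IsMinkowski.legendre_smul (t : ℝ) (x : V) : legendre (t • x) = t • legendre x := by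
  rcases eq_or_ne x 0 with rfl | hx
  · simp [legendre_zero]
  rcases eq_or_ne t 0 with rfl | ht
  · simp [legendre_zero]
  rw [hV.legendre_eq hx, hV.legendre_eq (smul_ne_zero ht hx), fderiv_norm_smul, smul_smul,
    smul_smul, norm_smul, Real.norm_eq_abs]
  congr 1
  rw [mul_right_comm, mul_comm |t|, sign_mul_abs]

theorem IsMinkowski.legendre_self (x : V) : legendre x x = ‖x‖ ^ 2 := by
  rcases eq_or_ne x 0 with rfl | hx
  · simp
  rw [hV.legendre_eq hx, smul_apply,
    (hV.differentiableAt_norm hx).fderiv_norm_self, smul_eq_mul, sq]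

theorem IsMinkowski.norm_fderiv_norm {x : V} (hx : x ≠ 0) :
    ‖fderiv ℝ (fun y : V => ‖y‖) x‖ = 1 :=
  haveI : Nontrivial V := ⟨x, 0, hx⟩
  _root_.norm_fderiv_norm (hV.differentiableAt_norm hx)

theorem IsMinkowski.norm_legendre (x : V) : ‖legendre x‖ = ‖x‖ := by
  rcases eq_or_ne x 0 with rfl | hx
  · simp [legendre_zero]
  rw [hV.legendre_eq hx, norm_smul, norm_norm, hV.norm_fderiv_norm hx, mul_one]

theorem IsMinkowski.contDiffOn_legendre :
    ContDiffOn ℝ ∞ (legendre : V → StrongDual ℝ V) {0}ᶜ :=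
  ((hV.smooth.pow 2).div_const 2).fderiv_of_isOpen isOpen_compl_singleton (by simp)

theorem IsMinkowski.contDiffAt_legendre {x : V} (hx : x ≠ 0) :
    ContDiffAt ℝ ∞ (legendre : V → StrongDual ℝ V) x :=
  hV.contDiffOn_legendre.contDiffAt (isOpen_compl_singleton.mem_nhds hx)

theorem IsMinkowski.hasFDerivAt_legendre {x : V} (hx : x ≠ 0) :
    HasFDerivAt (legendre : V → StrongDual ℝ V) (hessian x) x :=
  ((hV.contDiffAt_legendre hx).differentiableAt (by simp)).hasFDerivAt

theorem IsMinkowski.contDiffOn_hessian :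
    ContDiffOn ℝ ∞ (hessian : V → V →L[ℝ] StrongDual ℝ V) {0}ᶜ :=
  hV.contDiffOn_legendre.fderiv_of_isOpen isOpen_compl_singleton (by simp)

theorem IsMinkowski.hessian_pos {x w : V} (hx : x ≠ 0) (hw : w ≠ 0) : 0 < hessian x w w :=
  hV.posDef x hx w hw

theorem IsMinkowski.hessian_smul {t : ℝ} (ht : t ≠ 0) {x : V} (hx : x ≠ 0) :
    hessian (t • x) = hessian x := by
  have h1 : HasFDerivAt (fun y : V => legendre (t • y))
      (hessian (t • x) ∘L (t • ContinuousLinearMap.id ℝ V)) x :=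
    (hV.hasFDerivAt_legendre (smul_ne_zero ht hx)).comp x ((hasFDerivAt_id x).const_smul t)
  have h2 : HasFDerivAt (fun y : V => legendre (t • y)) (t • hessian x) x := by
    simp only [hV.legendre_smul]
    exact (hV.hasFDerivAt_legendre hx).const_smul t
  have h := h1.unique h2
  ext w z
  have := congrArg (fun L => L w z) h
  simpa [ht] using this

/-- Euler's identity for a map of degree one, obtained by differentiating along the ray through `x`.
-/
theorem IsMinkowski.hessian_self {x : V} (hx : x ≠ 0) : hessian x x = legendre x := by
  have h1 : HasDerivAt (fun t : ℝ => legendre (x + t • x)) (hessian x x) 0 := by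
    have := (hV.hasFDerivAt_legendre (x := x + (0 : ℝ) • x) (by simpa)).comp_hasDerivAt (0 : ℝ)
      (((hasDerivAt_id (0 : ℝ)).smul_const x).const_add x)
    simpa [Function.comp_def] using this
  have h2 : HasDerivAt (fun t : ℝ => legendre (x + t • x)) (legendre x) 0 := by
    have : (fun t : ℝ => legendre (x + t • x)) = fun t : ℝ => (1 + t) • legendre x := by
      ext1 t
      rw [← hV.legendre_smul, add_smul, one_smul]
    rw [this]
    simpa using ((hasDerivAt_id (0 : ℝ)).const_add 1).smul_const (legendre x)
  exact h1.unique h2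

theorem IsMinkowski.hessian_symm {x : V} (hx : x ≠ 0) (w z : V) :
    hessian x w z = hessian x z w := by
  have h : ContDiffAt ℝ ∞ (fun y : V => ‖y‖ ^ 2 / 2) x := ((hV.contDiffAt_norm hx).pow 2).div_const 2
  exact (h.isSymmSndFDerivAt (by simpa using WithTop.coe_le_coe.2 (le_top : (2 : ℕ∞) ≤ ⊤))).eq w z

omit hV in
theorem exists_smul_eq_of_zero_mem_segment {x y : V} (h : (0 : V) ∈ segment ℝ x y) :
    ∃ (z : V) (s t : ℝ), x = s • z ∧ y = t • z := by
  obtain ⟨a, b, ha, hb, hab, h0⟩ := h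
  rcases eq_or_ne a 0 with rfl | ha'
  · obtain rfl : b = 1 := by simpa using hab
    exact ⟨x, 1, 0, by simp, by simpa using h0⟩
  · refine ⟨y, -(a⁻¹ * b), 1, ?_, by simp⟩
    have : a • x = -(b • y) := eq_neg_of_add_eq_zero_left h0
    rw [neg_smul, mul_smul, ← smul_neg, ← this, smul_smul, inv_mul_cancel₀ ha', one_smul]

variable [FiniteDimensional ℝ V]

/-- The Hessian is homogeneous of degree zero, so compactness of the unit sphere makes its bounds
uniform. -/
theorem IsMinkowski.exists_hessian_bounds : ∃ c C : ℝ, 0 < c ∧ 0 < C ∧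
    ∀ x : V, x ≠ 0 → ‖hessian x‖ ≤ C ∧ ∀ w, c * ‖w‖ ^ 2 ≤ hessian x w w := by
  have hS : IsCompact (sphere (0 : V) 1) := isCompact_sphere 0 1
  have hcont : ContinuousOn (hessian : V → V →L[ℝ] StrongDual ℝ V) (sphere (0 : V) 1) :=
    hV.contDiffOn_hessian.continuousOn.mono fun x hx => ne_zero_of_mem_unit_sphere ⟨x, hx⟩
  obtain ⟨C, hC⟩ := hS.bddAbove_image 
    ((continuous_norm (E := V →L[ℝ] StrongDual ℝ V)).comp_continuousOn hcont)
  have hc2 : ContinuousOn (fun p : V × V => hessian p.1 p.2 p.2)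
      (sphere (0 : V) 1 ×ˢ sphere (0 : V) 1) :=
    ((hcont.comp continuousOn_fst fun p hp => hp.1).clm_apply continuousOn_snd).clm_apply
      continuousOn_snd
  obtain ⟨c, hc, hcb⟩ : ∃ c : ℝ, 0 < c ∧ ∀ x ∈ sphere (0 : V) 1, ∀ w ∈ sphere (0 : V) 1,
      c ≤ hessian x w w := by
    -- The sphere is empty when `V` is trivial; any positive constant then serves.
    rcases (sphere (0 : V) 1 ×ˢ sphere (0 : V) 1).eq_empty_or_nonempty with he | hne
    · exact ⟨1, one_pos, fun x hx w hw => by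
        have : (x, w) ∈ sphere (0 : V) 1 ×ˢ sphere (0 : V) 1 := ⟨hx, hw⟩
        rw [he] at this; exact this.elim⟩
    · obtain ⟨p, hp, hmin⟩ := (hS.prod hS).exists_isMinOn hne hc2
      exact ⟨_, hV.hessian_pos (ne_zero_of_mem_unit_sphere ⟨_, hp.1⟩)
        (ne_zero_of_mem_unit_sphere ⟨_, hp.2⟩), fun x hx w hw => isMinOn_iff.1 hmin (x, w) ⟨hx, hw⟩⟩
  refine ⟨c, max C 1, hc, by positivity, fun x hx => ?_⟩
  have hx' : ‖x‖⁻¹ • x ∈ sphere (0 : V) 1 := by simp [norm_smul, hx]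
  have hh : hessian x = hessian (‖x‖⁻¹ • x) := (hV.hessian_smul (by simpa) hx).symm
  rw [hh]
  refine ⟨(hC (mem_image_of_mem _ hx')).trans (le_max_left _ _), fun w => ?_⟩
  rcases eq_or_ne w 0 with rfl | hw
  · simp
  have hw' : ‖w‖⁻¹ • w ∈ sphere (0 : V) 1 := by simp [norm_smul, hw]
  have := hcb _ hx' _ hw'
  simp only [map_smul, smul_apply, smul_eq_mul] at this
  have hw0 : 0 < ‖w‖ := norm_pos_iff.2 hw
  calc c * ‖w‖ ^ 2 ≤ (‖w‖⁻¹ * (‖w‖⁻¹ * hessian (‖x‖⁻¹ • x) w w)) * ‖w‖ ^ 2 := by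
        gcongr
    _ = _ := by field_simp

/-- The Hessian bounds are integrated along the segment from `y` to `x`. If the segment meets the
origin, where there is no Hessian, both ends lie on one line and homogeneity gives the estimates
with constant `1`; hence `min c 1` and `max C 1`. -/
theorem IsMinkowski.exists_strongMono : ∃ c C : ℝ, 0 < c ∧ 0 < C ∧ ∀ x y : V,
    c * ‖x - y‖ ^ 2 ≤ (legendre x - legendre y) (x - y) ∧
      ‖legendre x - legendre y‖ ≤ C * ‖x - y‖ := by
  obtain ⟨c, C, hc, hC, hb⟩ := hV.exists_hessian_bounds
  refine ⟨min c 1, max C 1, by positivity, by positivity, fun x y => ?_⟩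
  by_cases h0 : (0 : V) ∈ segment ℝ x y
  · obtain ⟨z, s, t, rfl, rfl⟩ := exists_smul_eq_of_zero_mem_segment h0
    rw [hV.legendre_smul, hV.legendre_smul, ← sub_smul s t z, ← sub_smul s t (legendre z)]
    constructor
    · simp only [norm_smul, map_smul, smul_apply, hV.legendre_self,
        smul_eq_mul, Real.norm_eq_abs, mul_pow, sq_abs]
      have : min c 1 ≤ 1 := min_le_right _ _
      nlinarith [mul_nonneg (sq_nonneg (s - t)) (sq_nonneg ‖z‖)]
    · rw [norm_smul, norm_smul, hV.norm_legendre]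
      exact le_mul_of_one_le_left (by positivity) (le_max_right _ _)
  · have hseg : ∀ z ∈ segment ℝ y x, z ≠ 0 := by
      rintro z hz rfl
      exact h0 (segment_symm ℝ x y ▸ hz)
    constructor
    · have hmem : ∀ t ∈ Icc (0 : ℝ) 1, y + t • (x - y) ∈ segment ℝ y x := by
        intro t ht
        rw [segment_eq_image']
        exact ⟨t, ht, rfl⟩
      have hd : ∀ t ∈ Icc (0 : ℝ) 1, HasDerivAt (fun t : ℝ => legendre (y + t • (x - y)) (x - y))
          (hessian (y + t • (x - y)) (x - y) (x - y)) t := by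
        intro t ht
        have h1 := (hV.hasFDerivAt_legendre (hseg _ (hmem t ht))).comp_hasDerivAt t
          (((hasDerivAt_id t).smul_const (x - y)).const_add y)
        simpa using h1.clm_apply (hasDerivAt_const t (x - y))
      obtain ⟨t, ht, he⟩ := exists_hasDerivAt_eq_slope
        (fun t : ℝ => legendre (y + t • (x - y)) (x - y)) _ one_pos
        (fun t ht => (hd t ht).continuousAt.continuousWithinAt)
        (fun t ht => hd t (Ioo_subset_Icc_self ht))
      have := (hb _ (hseg _ (hmem t (Ioo_subset_Icc_self ht)))).2 (x - y)
      rw [he] at this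
      simp only [one_smul, add_sub_cancel, zero_smul, add_zero, sub_zero, div_one] at this
      rw [sub_apply]
      refine le_trans ?_ this
      gcongr
      exact min_le_left _ _
    · have := (convex_segment y x).norm_image_sub_le_of_norm_hasFDerivWithin_le (𝕜 := ℝ)
        (f := legendre) (f' := hessian) (C := C)
        (fun z hz => (hV.hasFDerivAt_legendre (hseg z hz)).hasFDerivWithinAt)
        (fun z hz => (hb z (hseg z hz)).1) (left_mem_segment ℝ y x) (right_mem_segment ℝ y x)
      exact this.trans (by gcongr; exact le_max_left _ _)

theorem IsMinkowski.legendre_injective :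
    Function.Injective (legendre : V → StrongDual ℝ V) := by
  obtain ⟨c, C, hc, hC, h⟩ := hV.exists_strongMono
  intro x y hxy
  have := (h x y).1
  rw [hxy, sub_self, zero_apply] at this
  have h2 : ‖x - y‖ ^ 2 ≤ 0 := by nlinarith [sq_nonneg ‖x - y‖]
  exact sub_eq_zero.1 (norm_eq_zero.1 (pow_eq_zero_iff two_ne_zero |>.1 (le_antisymm h2 (sq_nonneg _))))

/-- Over the image of a linear map `L`, the Legendre map takes every value, up to the
annihilator of the image. -/
theorem IsMinkowski.exists_legendre_comp_eq {E : Type*} [NormedAddCommGroup E] [NormedSpace ℝ E]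
    [FiniteDimensional ℝ E] (L : E →L[ℝ] V) (hL : Function.Injective L) (p : StrongDual ℝ V) :
    ∃ y : E, (∀ z, legendre (L y) (L z) = p (L z)) ∧ ‖L y‖ ≤ ‖p‖ := by
  obtain ⟨K, hK, hanti⟩ := L.toLinearMap.exists_antilipschitzWith (LinearMap.ker_eq_bot.2 hL)
  have hanti' : ∀ y, ‖y‖ ≤ K * ‖L y‖ := fun y => by
    simpa [dist_eq_norm] using hanti.le_mul_dist y 0
  have hcont : Continuous fun y : E => ‖L y‖ ^ 2 / 2 - p (L y) := by fun_prop
  have hlow : ∀ y : E, ‖L y‖ ^ 2 / 2 - ‖p‖ * ‖L y‖ ≤ ‖L y‖ ^ 2 / 2 - p (L y) := fun y => by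
    linarith [(le_abs_self _).trans (p.le_opNorm (L y))]
  -- The required point is a minimizer of this coercive function: its critical point equation is the
  -- claim.
  obtain ⟨y, hy⟩ : ∃ y, ∀ z, ‖L y‖ ^ 2 / 2 - p (L y) ≤ ‖L z‖ ^ 2 / 2 - p (L z) := by
    refine hcont.exists_forall_le_of_isBounded 0 ?_
    refine (isBounded_iff_forall_norm_le).2 ⟨K * (2 * ‖p‖), fun y hy => ?_⟩
    simp only [mem_ofPred_eq, map_zero, norm_zero] at hy
    have h2 : ‖L y‖ ≤ 2 * ‖p‖ := by
      by_contra hcon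
      push Not at hcon
      have := hlow y
      nlinarith [norm_nonneg p, norm_nonneg (L y)]
    exact (hanti' y).trans (by gcongr)
  have hd := hV.hasFDerivAt_norm_sq (L y)
  have h1 : ∀ z, legendre (L y) (L z) = p (L z) := by
    intro z
    have hmin : IsLocalMin (fun y : E => ‖L y‖ ^ 2 / 2 - p (L y)) y :=
      Filter.Eventually.of_forall hy
    have hD : HasFDerivAt (fun y : E => ‖L y‖ ^ 2 / 2 - p (L y))
        ((legendre (L y)).comp L - p.comp L) y :=
      (hd.comp y L.hasFDerivAt).sub (p.comp L).hasFDerivAt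
    have := congrArg (fun T => T z) (hmin.hasFDerivAt_eq_zero hD)
    simpa [sub_eq_zero] using this
  refine ⟨y, h1, ?_⟩
  -- Testing with `z = y` gives `‖L y‖² = p (L y) ≤ ‖p‖ ‖L y‖`.
  have h2 := h1 y
  rw [hV.legendre_self] at h2
  have h3 := (le_abs_self _).trans (p.le_opNorm (L y))
  rw [← h2] at h3
  rcases (norm_nonneg (L y)).eq_or_lt with h0 | h0
  · rw [← h0]; positivity
  · nlinarith

theorem IsMinkowski.legendre_surjective :
    Function.Surjective (legendre : V → StrongDual ℝ V) := fun p => by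
  obtain ⟨y, hy, -⟩ := hV.exists_legendre_comp_eq (ContinuousLinearMap.id ℝ V)
    Function.injective_id p
  exact ⟨y, ContinuousLinearMap.ext hy⟩

end LegendreMap

/-! ### Simple `k`-vectors and their frames -/

section Frames

/-- Both sides are alternating in the rows of `A`, so it suffices to compare them on permutations of
the standard basis. -/
theorem alternating_linearCombination {M N : Type*} [AddCommGroup M] [Module ℝ M]
    [AddCommGroup N] [Module ℝ N] {k : ℕ} (η : M [⋀^Fin k]→ₗ[ℝ] N)
    (A : Matrix (Fin k) (Fin k) ℝ) (v : Fin k → M) :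
    η (fun i => ∑ j, A i j • v j) = A.det • η v := by
  have h : η.compLinearMap (Fintype.linearCombination ℝ v) =
      (LinearMap.toSpanSingleton ℝ N (η v)).compAlternatingMap Matrix.detRowAlternating := by
    refine Module.Basis.ext_alternating (Pi.basisFun ℝ (Fin k)) fun f hf => ?_
    obtain ⟨σ, rfl⟩ : ∃ σ : Equiv.Perm (Fin k), f = σ :=
      ⟨Equiv.ofBijective f (Finite.injective_iff_bijective.1 hf), rfl⟩
    have h1 : (Matrix.detRowAlternating : (Fin k → ℝ) [⋀^Fin k]→ₗ[ℝ] ℝ)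
        (Pi.basisFun ℝ (Fin k)) = 1 := by
      rw [← Matrix.det_one (R := ℝ) (n := Fin k)]
      refine congrArg Matrix.det ?_
      ext i j
      simp [Matrix.one_apply, Pi.single_apply, eq_comm]
    have h2 : (fun i => Fintype.linearCombination ℝ v ((Pi.basisFun ℝ (Fin k)) (σ i))) = v ∘ σ := by
      ext1 i
      simp
    have h3 := (Matrix.detRowAlternating : (Fin k → ℝ) [⋀^Fin k]→ₗ[ℝ] ℝ).map_perm
      (Pi.basisFun ℝ (Fin k)) σ
    rw [h1] at h3
    rw [AlternatingMap.compLinearMap_apply, h2, LinearMap.compAlternatingMap_apply,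
      AlternatingMap.map_perm]
    refine Eq.trans ?_ (congrArg (LinearMap.toSpanSingleton ℝ N (η v)) h3.symm)
    simp
  have := congrArg (fun F : (Fin k → ℝ) [⋀^Fin k]→ₗ[ℝ] N => F A) h
  exact this

theorem alternating_comp_euclidean {M : Type*} [AddCommGroup M] [Module ℝ M] {k : ℕ}
    (η : M [⋀^Fin k]→ₗ[ℝ] ℝ) (T : EuclideanSpace ℝ (Fin k) →ₗ[ℝ] M)
    (A : EuclideanSpace ℝ (Fin k) →ₗ[ℝ] EuclideanSpace ℝ (Fin k)) :
    η (fun j => T (A (EuclideanSpace.single j 1))) =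
      LinearMap.det A * η (fun j => T (EuclideanSpace.single j 1)) := by
  set e := (EuclideanSpace.basisFun (Fin k) ℝ).toBasis with he
  have h := (η.compLinearMap T).eq_smul_basis_det e
  have h1 : (fun j => T (A (EuclideanSpace.single j 1))) = fun j => T ((A ∘ e) j) := by
    ext1 j; simp [he]
  have h2 : (fun j => T (EuclideanSpace.single j (1 : ℝ))) = fun j => T (e j) := by
    ext1 j; simp [he]
  rw [h1, h2]
  change (η.compLinearMap T) (A ∘ e) = _ * (η.compLinearMap T) e
  conv_lhs => rw [h]
  rw [AlternatingMap.smul_apply, Module.Basis.det_comp, Module.Basis.det_self, smul_eq_mul]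
  ring

variable {V : Type*} [NormedAddCommGroup V] [NormedSpace ℝ V] {k : ℕ}

/-- The linear map `y ↦ ∑ yᵢ vᵢ` from `ℝᵏ` to `V`. -/
noncomputable def frameMap (v : Fin k → V) : EuclideanSpace ℝ (Fin k) →L[ℝ] V :=
  ∑ i, (EuclideanSpace.proj i : EuclideanSpace ℝ (Fin k) →L[ℝ] ℝ).smulRight (v i)

theorem frameMap_apply (v : Fin k → V) (y : EuclideanSpace ℝ (Fin k)) :
    frameMap v y = ∑ i, y i • v i := by
  simp [frameMap]

@[simp]
theorem frameMap_single (v : Fin k → V) (i : Fin k) :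
    frameMap v (EuclideanSpace.single i 1) = v i := by
  simp [frameMap_apply]

theorem frameMap_injective {v : Fin k → V} (hv : LinearIndependent ℝ v) :
    Function.Injective (frameMap v) := by
  rw [injective_iff_map_eq_zero]
  intro y hy
  rw [frameMap_apply] at hy
  ext i
  exact Fintype.linearIndependent_iff.1 hv _ hy i

theorem range_frameMap (v : Fin k → V) : range (frameMap v) = Submodule.span ℝ (range v) := by
  ext x
  rw [SetLike.mem_coe, Submodule.mem_span_range_iff_exists_fun]
  constructor
  · rintro ⟨y, rfl⟩
    exact ⟨y, (frameMap_apply v y).symm⟩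
  · rintro ⟨c, rfl⟩
    exact ⟨WithLp.toLp 2 c, by simp [frameMap_apply]⟩

theorem contDiff_frameMap : ContDiff ℝ ∞ (frameMap : (Fin k → V) → _) := by
  unfold frameMap
  refine ContDiff.sum fun i _ => ?_
  exact ((ContinuousLinearMap.smulRightL ℝ (EuclideanSpace ℝ (Fin k)) V
    (EuclideanSpace.proj i : EuclideanSpace ℝ (Fin k) →L[ℝ] ℝ)).contDiff).comp (contDiff_apply ℝ V i)

variable [FiniteDimensional ℝ V]

theorem proj_apply (v : Fin k → V) (p : StrongDual ℝ V) (i : Fin k) : proj v p i = p (v i) := rfl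

theorem inner_proj (v : Fin k → V) (p : StrongDual ℝ V) (y : EuclideanSpace ℝ (Fin k)) :
    inner ℝ y (proj v p) = p (frameMap v y) := by
  simp [frameMap_apply, PiLp.inner_apply, proj_apply, mul_comm]

theorem exists_dual_apply_eq {ι : Type*} [Finite ι] {v : ι → V} (hv : LinearIndependent ℝ v) (c : ι → ℝ) :
    ∃ p : StrongDual ℝ V, ∀ i, p (v i) = c i := by
  obtain ⟨g, hg⟩ := ((Module.Basis.span hv).constr ℝ c).exists_extend
  refine ⟨LinearMap.toContinuousLinearMap g, fun i => ?_⟩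
  have := congrArg (fun f => f ((Module.Basis.span hv) i)) hg
  have h2 : Module.Basis.span hv i = ⟨v i, Submodule.subset_span ⟨i, rfl⟩⟩ :=
    Module.Basis.span_apply hv i
  have h3 := (Module.Basis.span hv).constr_basis ℝ c i
  rw [← h3, ← this, h2]
  rfl

theorem proj_surjective {v : Fin k → V} (hv : LinearIndependent ℝ v) :
    Function.Surjective (proj v) := fun y => by
  obtain ⟨p, hp⟩ := exists_dual_apply_eq hv y
  exact ⟨p, by ext i; exact hp i⟩

theorem exists_toForm_ne_zero {v : Fin k → V} (hv : LinearIndependent ℝ v) :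
    ∃ q : Fin k → StrongDual ℝ V, toForm (exteriorPower.ιMulti ℝ k v) q ≠ 0 := by
  choose q hq using fun i : Fin k => exists_dual_apply_eq hv (Pi.single i (1 : ℝ))
  refine ⟨q, ?_⟩
  have : (Matrix.of fun i j => q j (v i)) = (1 : Matrix (Fin k) (Fin k) ℝ) := by
    ext i j
    simp [hq, Matrix.one_apply, Pi.single_apply]
  rw [toForm_ιMulti, this]
  simp

theorem ιMulti_ne_zero_iff {v : Fin k → V} :
    exteriorPower.ιMulti ℝ k v ≠ 0 ↔ LinearIndependent ℝ v := by
  constructor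
  · intro h
    by_contra hv
    exact h (AlternatingMap.map_linearDependent _ _ hv)
  · intro hv h
    obtain ⟨q, hq⟩ := exists_toForm_ne_zero hv
    refine hq ?_
    have h0 := toForm_smul (0 : ℝ) (0 : ⋀[ℝ]^k V)
    rw [zero_smul, zero_smul] at h0
    rw [h, h0, AlternatingMap.zero_apply]

theorem ιMulti_frame {a : ⋀[ℝ]^k V} (ha : a ∈ grassmannCone k V) :
    exteriorPower.ιMulti ℝ k (frame a) = a :=
  Function.invFun_eq ha

/-- A simple `k`-vector, as a form on `V*`, is the pullback of the standard volume form by the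
projection along its frame; this turns form values into Jacobians. -/
theorem toForm_ιMulti_comp (w : Fin k → V) (T : EuclideanSpace ℝ (Fin k) →L[ℝ] StrongDual ℝ V) :
    toForm (exteriorPower.ιMulti ℝ k w) (fun j => T (EuclideanSpace.single j 1)) =
      ((proj w).comp T).det := by
  rw [toForm_ιMulti, ContinuousLinearMap.det,
    ← LinearMap.det_toMatrix (EuclideanSpace.basisFun (Fin k) ℝ).toBasis]
  congr 1

/-- Evaluation of `k`-vectors on `k` covectors. -/
noncomputable def toFormEval (q : Fin k → StrongDual ℝ V) : StrongDual ℝ (⋀[ℝ]^k V) :=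
  LinearMap.toContinuousLinearMap
    { toFun := fun a => toForm a q
      map_add' := fun a b => by simp [toForm_add]
      map_smul' := fun c a => by simp [toForm_smul] }

@[simp]
theorem toFormEval_apply (q : Fin k → StrongDual ℝ V) (a : ⋀[ℝ]^k V) :
    toFormEval q a = toForm a q := rfl

/-- The contraction of a `k`-vector with the covectors `qᵢ`, `i ≠ j`. -/
noncomputable def contraction (q : Fin k → StrongDual ℝ V) (j : Fin k) : ⋀[ℝ]^k V →L[ℝ] V :=
  ∑ l, (toFormEval (Function.update q j (LinearMap.toContinuousLinearMap
    ((Module.finBasis ℝ V).coord l)))).smulRight (Module.finBasis ℝ V l)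

/-- The matrix of values of covectors on vectors. -/
def evalMatrix (w : Fin k → V) (q : Fin k → StrongDual ℝ V) : Matrix (Fin k) (Fin k) ℝ :=
  Matrix.of fun i j => q j (w i)

/-- Cramer's rule: contracting is linear in the `k`-vector and recovers combinations of the `wᵢ`,
which is how vectors of the plane are read off from the `k`-vector alone. -/
theorem contraction_ιMulti (q : Fin k → StrongDual ℝ V) (j : Fin k) (w : Fin k → V) :
    contraction q j (exteriorPower.ιMulti ℝ k w) = ∑ i, (evalMatrix w q).adjugate j i • w i := by
  have h : ∀ c : StrongDual ℝ V, toForm (exteriorPower.ιMulti ℝ k w) (Function.update q j c) =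
      ∑ i, (evalMatrix w q).adjugate j i * c (w i) := by
    intro c
    have : (Matrix.of fun i j' => Function.update q j c j' (w i)) =
        (evalMatrix w q).updateCol j (fun i => c (w i)) := by
      ext i j'
      rcases eq_or_ne j' j with rfl | hj
      · simp
      · simp [hj, evalMatrix]
    rw [toForm_ιMulti, this, ← Matrix.cramer_apply, Matrix.cramer_eq_adjugate_mulVec]
    rfl
  simp only [contraction, sum_apply, ContinuousLinearMap.smulRight_apply,
    toFormEval_apply, h, Finset.sum_smul]
  rw [Finset.sum_comm]
  refine Finset.sum_congr rfl fun i _ => ?_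
  conv_rhs => rw [← (Module.finBasis ℝ V).sum_repr (w i), Finset.smul_sum]
  exact Finset.sum_congr rfl fun l _ => by simp [mul_smul]

/-- Simple `k`-vectors which are proportional have frames related by a matrix. -/
theorem exists_matrix_of_ιMulti_eq_smul {w w' : Fin k → V} (hw : LinearIndependent ℝ w) {t : ℝ}
    (h : exteriorPower.ιMulti ℝ k w' = t • exteriorPower.ιMulti ℝ k w) (ht : t ≠ 0) :
    ∃ A : Matrix (Fin k) (Fin k) ℝ, A.det = t ∧ w' = fun i => ∑ j, A i j • w j := by
  obtain ⟨q, hq⟩ := exists_toForm_ne_zero hw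
  set Q := evalMatrix w q with hQ
  set Q' := evalMatrix w' q with hQ'
  have hd : Q.det ≠ 0 := by rwa [toForm_ιMulti] at hq
  have hd' : Q'.det = t * Q.det := by
    have := congrArg (fun b => toForm b q) h
    simp only [toForm_smul, toForm_ιMulti, AlternatingMap.smul_apply, smul_eq_mul] at this
    exact this
  -- Contractions of proportional `k`-vectors are proportional; multiplying by `Q'` and using `Q' *
  -- Q'.adjugate = det Q'` then isolates each `w' l`.
  have hc : ∀ j, ∑ i, Q'.adjugate j i • w' i = t • ∑ i, Q.adjugate j i • w i := fun j => by
    rw [← contraction_ιMulti, ← contraction_ιMulti, h, map_smul]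
  have key : ∀ l, Q'.det • w' l = t • ∑ i, (Q' * Q.adjugate) l i • w i := by
    intro l
    have h1 : ∑ j, Q' l j • ∑ i, Q'.adjugate j i • w' i =
        ∑ j, Q' l j • t • ∑ i, Q.adjugate j i • w i := by simp only [hc]
    have h2 : ∀ (B : Matrix (Fin k) (Fin k) ℝ) (u : Fin k → V),
        ∑ j, Q' l j • ∑ i, B j i • u i = ∑ i, (Q' * B) l i • u i := by
      intro B u
      simp only [Finset.smul_sum, smul_smul, Matrix.mul_apply, Finset.sum_smul]
      exact Finset.sum_comm
    simp only [smul_comm _ t, ← Finset.smul_sum] at h1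
    rw [h2, h2, Matrix.mul_adjugate] at h1
    rw [← h1]
    simp [Matrix.smul_apply, Matrix.one_apply, Finset.sum_ite_eq]
  refine ⟨Q.det⁻¹ • (Q' * Q.adjugate), ?_, ?_⟩
  · rcases k with - | k
    · have h0 : exteriorPower.ιMulti ℝ 0 w' = exteriorPower.ιMulti ℝ 0 w := by
        congr 1; exact Subsingleton.elim _ _
      rw [h0] at h
      have h1 : (1 - t) • exteriorPower.ιMulti ℝ 0 w = 0 := by
        rw [sub_smul, one_smul, ← h, sub_self]
      have := (smul_eq_zero.1 h1).resolve_right (ιMulti_ne_zero_iff.2 hw)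
      simp; linarith
    · rw [Matrix.det_smul, Matrix.det_mul, Matrix.det_adjugate, hd']
      simp only [Fintype.card_fin, Nat.add_sub_cancel]
      rw [inv_pow, pow_succ]
      field_simp
  · ext1 l
    have h1 := key l
    rw [hd', mul_smul] at h1
    have h2 := smul_right_injective V ht h1
    simp only [Matrix.smul_apply, smul_eq_mul, mul_smul, ← Finset.smul_sum]
    rw [← h2, smul_smul, inv_mul_cancel₀ hd, one_smul]

end Frames

/-! ### Smooth local choice of frames -/

section LocalFrame

variable {V : Type*} [NormedAddCommGroup V] [NormedSpace ℝ V] [FiniteDimensional ℝ V] {m : ℕ}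

/-- A smooth choice of frames for the simple `k`-vectors on which the covectors `q` do not
vanish. -/
noncomputable def localFrame (q : Fin (m + 1) → StrongDual ℝ V) (a : ⋀[ℝ]^(m + 1) V) :
    Fin (m + 1) → V :=
  fun j => (Fin.cons 1 (fun _ => (toForm a q)⁻¹) : Fin (m + 1) → ℝ) j • contraction q j a

/-- With `d = toForm a q`, the `m + 1` contractions have wedge `d ^ m • a`, by the determinant of
the adjugate; dividing all of them but the first by `d` corrects this. -/
theorem ιMulti_localFrame (q : Fin (m + 1) → StrongDual ℝ V) {a : ⋀[ℝ]^(m + 1) V}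
    (ha : a ∈ grassmannCone (m + 1) V) (haq : toForm a q ≠ 0) :
    exteriorPower.ιMulti ℝ (m + 1) (localFrame q a) = a := by
  obtain ⟨w, rfl⟩ := ha
  have hd : (evalMatrix w q).det = toForm (exteriorPower.ιMulti ℝ (m + 1) w) q :=
    (toForm_ιMulti w q).symm
  unfold localFrame
  rw [AlternatingMap.map_smul_univ]
  simp only [contraction_ιMulti]
  rw [alternating_linearCombination, Matrix.det_adjugate, hd, smul_smul, Fin.prod_univ_succ]
  simp [inv_mul_cancel₀ (pow_ne_zero m haq)]

theorem isOpen_toForm_ne_zero (q : Fin (m + 1) → StrongDual ℝ V) :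
    IsOpen {a : ⋀[ℝ]^(m + 1) V | toForm a q ≠ 0} :=
  isOpen_ne_fun (toFormEval q).continuous continuous_const

theorem contDiffOn_localFrame (q : Fin (m + 1) → StrongDual ℝ V) :
    ContDiffOn ℝ ∞ (localFrame q) {a : ⋀[ℝ]^(m + 1) V | toForm a q ≠ 0} := by
  rw [contDiffOn_pi]
  intro j
  refine ContDiffOn.smul ?_ (contraction q j).contDiff.contDiffOn
  refine Fin.cases ?_ (fun i => ?_) j
  · exact contDiffOn_const
  · exact (toFormEval q).contDiff.contDiffOn.inv fun a ha => ha

end LocalFrame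

/-! ### The calibration inequality -/

section Calibration

variable {V : Type*} [NormedAddCommGroup V] [NormedSpace ℝ V] {m : ℕ}

/-- The unit ball of the plane spanned by `v`, without its centre, in the coordinates given by
`v`. -/
def puncturedBall (v : Fin (m + 1) → V) : Set (EuclideanSpace ℝ (Fin (m + 1))) :=
  {y | y ≠ 0 ∧ ‖frameMap v y‖ ≤ 1}

theorem measurableSet_puncturedBall (v : Fin (m + 1) → V) : MeasurableSet (puncturedBall v) :=
  (measurableSet_singleton 0).compl.inter
    (isClosed_le (frameMap v).continuous.norm continuous_const).measurableSet

theorem frameMap_ne_zero {v : Fin (m + 1) → V} (hv : LinearIndependent ℝ v)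
    {y : EuclideanSpace ℝ (Fin (m + 1))} (hy : y ≠ 0) : frameMap v y ≠ 0 := fun h =>
  hy (frameMap_injective hv (h.trans (map_zero _).symm))

variable [FiniteDimensional ℝ V]

/-- The pullback to the plane spanned by `v` of the form `b` under the Legendre map, evaluated on
`v`. -/
noncomputable def busemannIntegrand (v : Fin (m + 1) → V) (b : ⋀[ℝ]^(m + 1) V)
    (y : EuclideanSpace ℝ (Fin (m + 1))) : ℝ :=
  toForm b fun i => hessian (frameMap v y) (v i)

/-- The integral of the form `b` over the image of the unit ball of the plane spanned by `v` under
the Legendre map. -/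
noncomputable def busemannIntegral (v : Fin (m + 1) → V) (b : ⋀[ℝ]^(m + 1) V) : ℝ :=
  ∫ y in puncturedBall v, busemannIntegrand v b y

/-- The Legendre map on the plane spanned by `v`, followed by the restriction of covectors to the
plane spanned by `w`. -/
noncomputable def legendreProj (v w : Fin (m + 1) → V) (y : EuclideanSpace ℝ (Fin (m + 1))) :
    EuclideanSpace ℝ (Fin (m + 1)) :=
  proj w (legendre (frameMap v y))

variable (hV : IsMinkowski V)
include hV

theorem IsMinkowski.hasFDerivAt_legendreProj {v : Fin (m + 1) → V} (hv : LinearIndependent ℝ v)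
    (w : Fin (m + 1) → V) {y : EuclideanSpace ℝ (Fin (m + 1))} (hy : y ≠ 0) :
    HasFDerivAt (legendreProj v w)
      ((proj w).comp ((hessian (frameMap v y)).comp (frameMap v))) y :=
  (proj w).hasFDerivAt.comp y
    ((hV.hasFDerivAt_legendre (frameMap_ne_zero hv hy)).comp y (frameMap v).hasFDerivAt)

omit hV in
theorem det_fderiv_legendreProj (v w : Fin (m + 1) → V) (y : EuclideanSpace ℝ (Fin (m + 1))) :
    ((proj w).comp ((hessian (frameMap v y)).comp (frameMap v))).det =
      busemannIntegrand v (exteriorPower.ιMulti ℝ (m + 1) w) y := by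
  rw [← toForm_ιMulti_comp]
  simp [busemannIntegrand]

/-- The integrand is the Gram determinant of the Hessian on the frame `v`. -/
theorem IsMinkowski.busemannIntegrand_self_pos {v : Fin (m + 1) → V} (hv : LinearIndependent ℝ v)
    {y : EuclideanSpace ℝ (Fin (m + 1))} (hy : y ≠ 0) :
    0 < busemannIntegrand v (exteriorPower.ιMulti ℝ (m + 1) v) y := by
  have hx := frameMap_ne_zero hv hy
  rw [busemannIntegrand, toForm_ιMulti]
  refine Matrix.PosDef.det_pos (Matrix.PosDef.of_dotProduct_mulVec_pos ?_ fun z hz => ?_)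
  · ext i j
    exact hV.hessian_symm hx _ _
  · have hz' : (WithLp.toLp 2 z : EuclideanSpace ℝ (Fin (m + 1))) ≠ 0 := fun h => hz (by
      ext i; simpa using congrArg (fun y : EuclideanSpace ℝ (Fin (m + 1)) => y i) h)
    have := hV.hessian_pos hx (frameMap_ne_zero hv hz')
    refine lt_of_lt_of_eq this ?_
    simp only [frameMap_apply, map_sum, map_smul, sum_apply, smul_apply,
      dotProduct, Matrix.mulVec, Matrix.of_apply, smul_eq_mul, Finset.mul_sum, Pi.star_apply,
      star_trivial]
    refine Finset.sum_congr rfl fun i _ => Finset.sum_congr rfl fun j _ => ?_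
    ring

/-- If two points have the same image, the difference `θ` of their Legendre images kills the
combination `δ` of the `wᵢ`, so on the corresponding combination of the `vᵢ` it is of size `‖w -
v‖`. Strong monotonicity bounds that value below by `c ‖frameMap v δ‖²`, forcing `δ = 0` once `‖w -
v‖ < c / (C K)`, with norms of the frame maps. The uniform constants make one neighbourhood work for
all pairs of points. -/
theorem IsMinkowski.eventually_injective_legendreProj {v : Fin (m + 1) → V}
    (hv : LinearIndependent ℝ v) :
    ∀ᶠ w in nhds v, Function.Injective (legendreProj v w) := by
  obtain ⟨c, C, hc, hC, hcC⟩ := hV.exists_strongMono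
  obtain ⟨K, hK, hanti⟩ := (frameMap v).toLinearMap.exists_antilipschitzWith
    (LinearMap.ker_eq_bot.2 (frameMap_injective hv))
  have hanti' : ∀ y, ‖y‖ ≤ K * ‖frameMap v y‖ := fun y => by
    simpa [dist_eq_norm] using hanti.le_mul_dist y 0
  have hK' : (0 : ℝ) < K := hK
  have hcont : Filter.Tendsto (fun w : Fin (m + 1) → V => ‖frameMap w - frameMap v‖) (nhds v)
      (nhds 0) := by
    have : Continuous fun w : Fin (m + 1) → V => ‖frameMap w - frameMap v‖ :=
      (contDiff_frameMap.continuous.sub continuous_const).norm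
    simpa using this.tendsto v
  filter_upwards [hcont.eventually (gt_mem_nhds (show 0 < c / (C * K) by positivity))] with w hw
  intro y z hyz
  set δ := y - z with hδ
  set θ := legendre (frameMap v y) - legendre (frameMap v z) with hθ
  have h0 : θ (frameMap w δ) = 0 := by
    rw [← inner_proj, hθ, map_sub]
    change inner ℝ δ (legendreProj v w y - legendreProj v w z) = 0
    rw [hyz, sub_self, inner_zero_right]
  obtain ⟨h1, h2⟩ := hcC (frameMap v y) (frameMap v z)
  rw [← map_sub] at h1 h2
  have h3 : ‖θ ((frameMap w - frameMap v) δ)‖ ≤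
      (C * ‖frameMap v δ‖) * (‖frameMap w - frameMap v‖ * (K * ‖frameMap v δ‖)) := by
    refine (θ.le_opNorm _).trans (mul_le_mul h2 ?_ (norm_nonneg _) (by positivity))
    exact ((frameMap w - frameMap v).le_opNorm δ).trans (by gcongr; exact hanti' δ)
  have h4 : θ (frameMap v δ) = -θ ((frameMap w - frameMap v) δ) := by
    have : (frameMap w - frameMap v) δ = frameMap w δ - frameMap v δ := rfl
    rw [this, θ.map_sub, h0]; ring
  have h5 : c * ‖frameMap v δ‖ ^ 2 ≤
      (C * ‖frameMap v δ‖) * (‖frameMap w - frameMap v‖ * (K * ‖frameMap v δ‖)) := by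
    refine (h1.trans (h4.le.trans ?_)).trans h3
    rw [Real.norm_eq_abs, ← abs_neg]
    exact le_abs_self _
  rw [lt_div_iff₀ (by positivity)] at hw
  have h6 : ‖frameMap v δ‖ = 0 := by
    by_contra hne
    have : 0 < ‖frameMap v δ‖ ^ 2 := by positivity
    nlinarith
  have h7 : δ = 0 := frameMap_injective hv ((norm_eq_zero.1 h6).trans (map_zero _).symm)
  exact sub_eq_zero.1 h7

theorem IsMinkowski.legendreProj_self_injective {v : Fin (m + 1) → V}
    (hv : LinearIndependent ℝ v) : Function.Injective (legendreProj v v) :=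
  (hV.eventually_injective_legendreProj hv).self_of_nhds

theorem IsMinkowski.volume_image_legendreProj {v w : Fin (m + 1) → V}
    (hv : LinearIndependent ℝ v) (hw : Function.Injective (legendreProj v w)) :
    volume.real (legendreProj v w '' puncturedBall v) =
      ∫ y in puncturedBall v, |busemannIntegrand v (exteriorPower.ιMulti ℝ (m + 1) w) y| := by
  have h := integral_image_eq_integral_abs_det_fderiv_smul volume (measurableSet_puncturedBall v)
    (fun y hy => (hV.hasFDerivAt_legendreProj hv w hy.1).hasFDerivWithinAt) hw.injOn
    (fun _ => (1 : ℝ))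
  simpa [det_fderiv_legendreProj] using h

omit hV in
theorem isCompact_proj_image {k : ℕ} (v : Fin k → V) :
    IsCompact (proj v '' closedBall (0 : StrongDual ℝ V) 1) :=
  (isCompact_closedBall _ _).image (proj v).continuous

/-- The calibration inequality: an integral of a Jacobian is at most the volume of the image of an
injective map, and the image lies in the projected dual ball because the Legendre map preserves
norms. -/
theorem IsMinkowski.eventually_busemannIntegral_le {v : Fin (m + 1) → V}
    (hv : LinearIndependent ℝ v) :
    ∀ᶠ w in nhds v, busemannIntegral v (exteriorPower.ιMulti ℝ (m + 1) w) ≤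
      volume.real (proj w '' closedBall (0 : StrongDual ℝ V) 1) := by
  filter_upwards [hV.eventually_injective_legendreProj hv] with w hw
  refine (le_abs_self _).trans (abs_integral_le_integral_abs.trans ?_)
  rw [← hV.volume_image_legendreProj hv hw]
  refine measureReal_mono ?_ (isCompact_proj_image w).measure_ne_top
  rintro _ ⟨y, hy, rfl⟩
  exact ⟨legendre (frameMap v y), by simpa [hV.norm_legendre] using hy.2, rfl⟩

/-- Equality in the calibration inequality: the Jacobian is positive, and by
`exists_legendre_comp_eq` every restriction of a covector of the dual ball comes from a point of the
unit ball of the plane, so only the centre is missed. -/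
theorem IsMinkowski.busemannIntegral_self {v : Fin (m + 1) → V} (hv : LinearIndependent ℝ v) :
    busemannIntegral v (exteriorPower.ιMulti ℝ (m + 1) v) =
      volume.real (proj v '' closedBall (0 : StrongDual ℝ V) 1) := by
  refine le_antisymm (hV.eventually_busemannIntegral_le hv).self_of_nhds ?_
  have h1 : busemannIntegral v (exteriorPower.ιMulti ℝ (m + 1) v) =
      volume.real (legendreProj v v '' puncturedBall v) := by
    rw [hV.volume_image_legendreProj hv (hV.legendreProj_self_injective hv)]
    exact setIntegral_congr_fun (measurableSet_puncturedBall v) fun y hy =>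
      (abs_of_pos (hV.busemannIntegrand_self_pos hv hy.1)).symm
  have h2 : proj v '' closedBall (0 : StrongDual ℝ V) 1 ⊆
      legendreProj v v '' puncturedBall v ∪ {0} := by
    rintro _ ⟨p, hp, rfl⟩
    obtain ⟨y, hy, hle⟩ := hV.exists_legendre_comp_eq (frameMap v) (frameMap_injective hv) p
    have he : legendreProj v v y = proj v p := by
      ext i
      have := hy (EuclideanSpace.single i 1)
      rwa [frameMap_single] at this
    rcases eq_or_ne y 0 with rfl | h0
    · right
      rw [← he]
      simp [legendreProj, legendre_zero]
    · exact Or.inl ⟨y, ⟨h0, hle.trans (by simpa using hp)⟩, he⟩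
  have h3 : legendreProj v v '' puncturedBall v ⊆
      proj v '' closedBall (0 : StrongDual ℝ V) 1 := by
    rintro _ ⟨y, hy, rfl⟩
    exact ⟨legendre (frameMap v y), by simpa [hV.norm_legendre] using hy.2, rfl⟩
  rw [h1]
  refine (measureReal_mono h2 ?_).trans ((measureReal_union_le _ _).trans (by simp [measureReal_def]))
  exact (measure_union_lt_top (measure_mono h3 |>.trans_lt (isCompact_proj_image v).measure_lt_top)
    (by simp)).ne

omit hV in
theorem volume_proj_pos {k : ℕ} {v : Fin k → V} (hv : LinearIndependent ℝ v) :
    0 < volume.real (proj v '' closedBall (0 : StrongDual ℝ V) 1) := by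
  have ho : IsOpen (proj v '' ball (0 : StrongDual ℝ V) 1) :=
    (proj v).isOpenMap (proj_surjective hv) _ isOpen_ball
  have hne : (proj v '' ball (0 : StrongDual ℝ V) 1).Nonempty := ⟨_, 0, by simp, rfl⟩
  refine ENNReal.toReal_pos ?_ (isCompact_proj_image v).measure_ne_top
  exact ((ho.measure_pos volume hne).trans_le
    (measure_mono (image_mono ball_subset_closedBall))).ne'

omit hV in
theorem volume_proj_eq_zero {k : ℕ} {v : Fin k → V} (hv : ¬LinearIndependent ℝ v) :
    volume.real (proj v '' closedBall (0 : StrongDual ℝ V) 1) = 0 := by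
  obtain ⟨g, hg, i, hi⟩ := Fintype.not_linearIndependent_iff.1 hv
  -- A linear relation `g` among the `vᵢ` is orthogonal to every projected covector, so the image
  -- lies in a proper subspace.
  have hr : LinearMap.range (proj v).toLinearMap ≠ ⊤ := by
    intro h
    obtain ⟨p, hp⟩ := LinearMap.range_eq_top.1 h (WithLp.toLp 2 g)
    have h1 := inner_proj v p (WithLp.toLp 2 g)
    have hp' : proj v p = WithLp.toLp 2 g := hp
    rw [hp', frameMap_apply] at h1
    have h2 : (WithLp.toLp 2 g : EuclideanSpace ℝ (Fin k)) = 0 := by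
      rw [← inner_self_eq_zero (𝕜 := ℝ), h1]
      simp [hg]
    exact hi (by simpa using congrArg (fun y : EuclideanSpace ℝ (Fin k) => y i) h2)
  have := Measure.addHaar_submodule volume _ hr
  rw [measureReal_def, measure_mono_null _ this, ENNReal.toReal_zero]
  rintro _ ⟨p, -, rfl⟩
  exact ⟨p, rfl⟩

omit hV in
theorem volume_proj_matrix {k : ℕ} (A : Matrix (Fin k) (Fin k) ℝ) (v : Fin k → V) :
    volume.real (proj (fun i => ∑ j, A i j • v j) '' closedBall (0 : StrongDual ℝ V) 1) =
      |A.det| * volume.real (proj v '' closedBall (0 : StrongDual ℝ V) 1) := by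
  have h : proj (fun i => ∑ j, A i j • v j) '' closedBall (0 : StrongDual ℝ V) 1 =
      Matrix.toEuclideanLin A '' (proj v '' closedBall (0 : StrongDual ℝ V) 1) := by
    rw [image_image]
    refine image_congr fun p _ => ?_
    ext i
    simp [proj_apply, Matrix.toLpLin_apply, Matrix.mulVec, dotProduct]
  rw [h, measureReal_def, Measure.addHaar_image_linearMap, ENNReal.toReal_mul,
    ENNReal.toReal_ofReal (abs_nonneg _), LinearMap.det_toLpLin]
  rfl

-- Substitution by the transpose of `A`: the integrand contributes `det A` and the volume `|det A|`,
-- so the integral changes only by the sign of `det A`.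
omit hV in
theorem busemannIntegral_matrix {A : Matrix (Fin (m + 1)) (Fin (m + 1)) ℝ} (hA : A.det ≠ 0)
    (v : Fin (m + 1) → V) (b : ⋀[ℝ]^(m + 1) V) :
    |A.det| * busemannIntegral (fun i => ∑ j, A i j • v j) b = A.det * busemannIntegral v b := by
  set T := (Matrix.toEuclideanLin A.transpose).toContinuousLinearMap with hT
  have hTdet : T.det = A.det := by
    rw [ContinuousLinearMap.det, hT, LinearMap.coe_toContinuousLinearMap,
      LinearMap.det_toLpLin, Matrix.det_transpose]
  have hTe : Function.Bijective T := by
    have h1 : IsUnit T.toLinearMap := by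
      rw [LinearMap.isUnit_iff_isUnit_det, ← ContinuousLinearMap.det, hTdet]
      exact hA.isUnit
    exact (Module.End.isUnit_iff _).1 h1
  have hmap : ∀ y, frameMap (fun i => ∑ j, A i j • v j) y = frameMap v (T y) := by
    intro y
    simp only [frameMap_apply, Finset.smul_sum, smul_smul]
    rw [Finset.sum_comm]
    refine Finset.sum_congr rfl fun j _ => ?_
    rw [← Finset.sum_smul]
    congr 1
    simp [hT, Matrix.toLpLin_apply, Matrix.mulVec, dotProduct, mul_comm]
  have himage : T '' puncturedBall (fun i => ∑ j, A i j • v j) = puncturedBall v := by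
    ext z
    constructor
    · rintro ⟨y, hy, rfl⟩
      refine ⟨fun h => hy.1 (hTe.1 (h.trans (map_zero T).symm)), ?_⟩
      rw [← hmap]; exact hy.2
    · intro hz
      obtain ⟨y, rfl⟩ := hTe.2 z
      refine ⟨y, ⟨fun h => hz.1 (by rw [h, map_zero]), ?_⟩, rfl⟩
      rw [hmap]; exact hz.2
  have hint : ∀ y, busemannIntegrand (fun i => ∑ j, A i j • v j) b y =
      A.det * busemannIntegrand v b (T y) := by
    intro y
    simp only [busemannIntegrand, hmap, map_sum, map_smul]
    exact alternating_linearCombination (toForm b) A _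
  have h := integral_image_eq_integral_abs_det_fderiv_smul volume
    (measurableSet_puncturedBall (fun i => ∑ j, A i j • v j))
    (fun y _ => T.hasFDerivAt.hasFDerivWithinAt) hTe.1.injOn (busemannIntegrand v b)
  rw [himage] at h
  rw [busemannIntegral, busemannIntegral, h]
  simp only [hint, hTdet, smul_eq_mul, integral_const_mul]
  ring

end Calibration

/-! ### Polar coordinates and integrals depending on a parameter -/

section Polar

theorem integral_volumeIoiPow_indicator (n : ℕ) {R : ℝ} (hR : 0 ≤ R) (c : ℝ) :
    ∫ r : Ioi (0 : ℝ), (Iic R).indicator (fun _ => c) (r : ℝ) ∂Measure.volumeIoiPow n =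
      R ^ (n + 1) / (n + 1) * c := by
  simp only [Measure.volumeIoiPow, ENNReal.ofReal]
  rw [integral_withDensity_eq_integral_smul (by fun_prop),
    integral_subtype_comap measurableSet_Ioi
      fun r : ℝ => Real.toNNReal (r ^ n) • (Iic R).indicator (fun _ => c) r]
  have h : ∀ r ∈ Ioi (0 : ℝ), Real.toNNReal (r ^ n) • (Iic R).indicator (fun _ => c) r =
      (Iic R).indicator (fun r => r ^ n * c) r := by
    intro r hr
    by_cases hrR : r ∈ Iic R
    · simp [hrR, NNReal.smul_def, pow_nonneg (le_of_lt (mem_Ioi.1 hr))]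
    · simp [hrR]
  rw [setIntegral_congr_fun measurableSet_Ioi h, setIntegral_indicator measurableSet_Iic,
    Ioi_inter_Iic, ← intervalIntegral.integral_of_le hR, intervalIntegral.integral_mul_const,
    integral_pow]
  simp

variable {E : Type*} [NormedAddCommGroup E] [NormedSpace ℝ E] [FiniteDimensional ℝ E]
  [MeasurableSpace E] [BorelSpace E] (μ : Measure E) [μ.IsAddHaarMeasure]

/-- On the ray through `u` the domain is `(0, 1 / N u]` and `h` is constant, so the radial integral
is `h u / ((m + 1) N(u)^(m+1))`. This moves the dependence on the domain into the integrand. -/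
theorem polar_setIntegral {m : ℕ} (hfin : Module.finrank ℝ E = m + 1) {h N : E → ℝ}
    (hc : ContinuousOn h {0}ᶜ) (hNc : Continuous N) (hN : ∀ y, y ≠ 0 → 0 < N y)
    (hh : ∀ t : ℝ, 0 < t → ∀ y, y ≠ 0 → h (t • y) = h y)
    (hNh : ∀ t : ℝ, 0 < t → ∀ y, N (t • y) = t * N y) :
    ∫ y in {y | y ≠ 0 ∧ N y ≤ 1}, h y ∂μ =
      1 / ((m + 1 : ℕ) : ℝ) * ∫ u : sphere (0 : E) 1,
        h u / N u ^ (m + 1) ∂μ.toSphere := by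
  have : Nontrivial E := Module.nontrivial_of_finrank_pos (R := ℝ) (by omega)
  set D : Set E := {y | y ≠ 0 ∧ N y ≤ 1} with hD
  have hDm : MeasurableSet D :=
    (measurableSet_singleton 0).compl.inter (isClosed_le hNc continuous_const).measurableSet
  have hS : IsCompact (sphere (0 : E) 1) := isCompact_sphere 0 1
  have hSne : (sphere (0 : E) 1).Nonempty := NormedSpace.sphere_nonempty.2 zero_le_one
  obtain ⟨u₀, hu₀, hmin⟩ := hS.exists_isMinOn hSne hNc.continuousOn
  have hN0 : 0 < N u₀ := hN _ (ne_zero_of_mem_unit_sphere ⟨u₀, hu₀⟩)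
  obtain ⟨C, hC⟩ := hS.exists_bound_of_continuousOn
    (hc.mono fun u hu => ne_zero_of_mem_unit_sphere ⟨u, hu⟩)
  have hnorm : ∀ y : E, y ≠ 0 → ‖y‖⁻¹ • y ∈ sphere (0 : E) 1 := fun y hy => by
    simp [norm_smul, hy]
  have hdec : ∀ y : E, y ≠ 0 → y = ‖y‖ • ‖y‖⁻¹ • y := fun y hy => by
    rw [smul_smul, mul_inv_cancel₀ (norm_ne_zero_iff.2 hy), one_smul]
  -- By homogeneity `N` dominates its minimum on the sphere times the norm; the domain is bounded,
  -- which gives the integrability needed for Fubini.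
  have hDb : D ⊆ closedBall 0 (N u₀)⁻¹ := by
    intro y hy
    have h1 := hNh ‖y‖ (norm_pos_iff.2 hy.1) (‖y‖⁻¹ • y)
    rw [← hdec y hy.1] at h1
    have h2 : N u₀ ≤ N (‖y‖⁻¹ • y) := isMinOn_iff.1 hmin _ (hnorm y hy.1)
    rw [mem_closedBall_zero_iff, ← one_div, le_div_iff₀ hN0]
    exact (mul_le_mul_of_nonneg_left h2 (norm_nonneg y)).trans (h1.symm.le.trans hy.2)
  have hDfin : μ D ≠ ⊤ :=
    ((measure_mono hDb).trans_lt measure_closedBall_lt_top).ne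
  have hint : IntegrableOn h D μ := by
    refine Measure.integrableOn_of_bounded (M := C) hDfin ?_ ?_
    · have := hc.aestronglyMeasurable (μ := μ) (measurableSet_singleton 0).compl
      rwa [restrict_compl_singleton] at this
    · filter_upwards [ae_restrict_mem hDm] with y hy
      rw [hdec y hy.1, hh _ (norm_pos_iff.2 hy.1) _ (smul_ne_zero (by simpa using hy.1) hy.1)]
      exact hC _ (hnorm y hy.1)
  set G : sphere (0 : E) 1 × Ioi (0 : ℝ) → ℝ := fun p => D.indicator h ((p.2 : ℝ) • (p.1 : E))
    with hG
  have hmp := μ.measurePreserving_homeomorphUnitSphereProd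
  have hGcomp : ∀ y : ({0}ᶜ : Set E), G (homeomorphUnitSphereProd E y) = D.indicator h y := by
    intro y
    rw [hG]
    simp only [homeomorphUnitSphereProd_apply_fst_coe, homeomorphUnitSphereProd_apply_snd_coe]
    rw [← hdec _ y.2]
  have hGint : Integrable G (μ.toSphere.prod
      (Measure.volumeIoiPow (Module.finrank ℝ E - 1))) := by
    rw [← hmp.integrable_comp_emb (Homeomorph.measurableEmbedding _)]
    have h1 : Integrable (D.indicator h) (μ.restrict ({0}ᶜ : Set E)) := by
      rw [restrict_compl_singleton]
      exact hint.integrable_indicator hDm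
    have h2 := (integrableOn_iff_comap_subtypeVal (measurableSet_singleton (0 : E)).compl).1 h1
    refine h2.congr (Filter.Eventually.of_forall fun y => (hGcomp y).symm)
  have hfr : Module.finrank ℝ E - 1 = m := by omega
  calc ∫ y in D, h y ∂μ = ∫ y in ({0}ᶜ : Set E), D.indicator h y ∂μ := by
        rw [restrict_compl_singleton, integral_indicator hDm]
    _ = ∫ y : ({0}ᶜ : Set E), D.indicator h y ∂(μ.comap (↑)) := by
        rw [integral_subtype_comap (measurableSet_singleton _).compl]
    _ = ∫ p, G p ∂(μ.toSphere.prod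
          (Measure.volumeIoiPow (Module.finrank ℝ E - 1))) := by
        rw [← hmp.integral_comp (Homeomorph.measurableEmbedding _)]
        simp only [hGcomp]
    _ = ∫ u, ∫ r, G (u, r) ∂(Measure.volumeIoiPow (Module.finrank ℝ E - 1))
          ∂μ.toSphere := integral_prod _ hGint
    _ = ∫ u : sphere (0 : E) 1, 1 / ((m + 1 : ℕ) : ℝ) * (h u / N u ^ (m + 1))
          ∂μ.toSphere := by
        refine integral_congr_ae (Filter.Eventually.of_forall fun u => ?_)
        have hu0 : (u : E) ≠ 0 := ne_zero_of_mem_unit_sphere u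
        have hNu := hN _ hu0
        have hGu : ∀ r : Ioi (0 : ℝ), G (u, r) =
            (Iic (N u)⁻¹).indicator (fun _ => h u) (r : ℝ) := by
          intro r
          have hr : (0 : ℝ) < r := r.2
          have hiff : (r : ℝ) • (u : E) ∈ D ↔ (r : ℝ) ∈ Iic (N u)⁻¹ := by
            rw [hD, mem_ofPred_eq, hNh _ hr, mem_Iic, ← one_div, le_div_iff₀ hNu]
            exact ⟨fun h => h.2, fun h => ⟨smul_ne_zero hr.ne' hu0, h⟩⟩
          by_cases hmem : (r : ℝ) ∈ Iic (N u)⁻¹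
          · rw [hG]
            simp only
            rw [indicator_of_mem (hiff.2 hmem), indicator_of_mem hmem, hh _ hr _ hu0]
          · rw [hG]
            simp only
            rw [indicator_of_notMem (fun h => hmem (hiff.1 h)), indicator_of_notMem hmem]
        simp only [hGu]
        rw [hfr, integral_volumeIoiPow_indicator m (inv_pos.2 hNu).le]
        push_cast
        rw [inv_pow]
        field_simp
    _ = _ := integral_const_mul _ _

/-- The integral is the value at `0` of a convolution of the constant `1`, for the sphere measure
pushed to `E`, with a compactly supported kernel depending smoothly on the parameter. -/
theorem contDiffOn_sphere_integral {P : Type*} [NormedAddCommGroup P] [NormedSpace ℝ P] {s : Set P}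
    (hs : IsOpen s) {g : P × E → ℝ}
    (hg : ContDiffOn ℝ ∞ g (s ×ˢ {0}ᶜ)) :
    ContDiffOn ℝ ∞ (fun p => ∫ u : sphere (0 : E) 1,
      g (p, u) ∂μ.toSphere) s := by
  let b₁ : ContDiffBump (0 : E) := ⟨2, 3, by norm_num, by norm_num⟩
  let b₀ : ContDiffBump (0 : E) := ⟨1 / 4, 1 / 2, by norm_num, by norm_num⟩
  -- This cutoff is `1` on the unit sphere, vanishes near the origin, where `g` need not be smooth,
  -- and outside the ball of radius `3`.
  set χ : E → ℝ := fun x => b₁ x * (1 - b₀ x) with hχ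
  have hχs : ContDiff ℝ ∞ χ := b₁.contDiff.mul (contDiff_const.sub b₀.contDiff)
  have hχ1 : ∀ u ∈ sphere (0 : E) 1, χ u = 1 := by
    intro u hu
    have h1 : b₁ u = 1 := b₁.one_of_mem_closedBall (by
      rw [mem_closedBall_zero_iff, mem_sphere_zero_iff_norm.1 hu]; norm_num)
    have h0 : b₀ u = 0 := b₀.zero_of_le_dist (by
      rw [dist_zero_right, mem_sphere_zero_iff_norm.1 hu]; norm_num)
    simp [hχ, h1, h0]
  have hχ0 : ∀ x ∈ ball (0 : E) (1 / 4), χ x = 0 := by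
    intro x hx
    have h0 : b₀ x = 1 := b₀.one_of_mem_closedBall (ball_subset_closedBall hx)
    simp [hχ, h0]
  have hχk : ∀ x ∉ closedBall (0 : E) 3, χ x = 0 := by
    intro x hx
    have h1 : b₁ x = 0 := b₁.zero_of_le_dist (by
      rw [mem_closedBall] at hx; exact (not_le.1 hx).le)
    simp [hχ, h1]
  set ν : Measure E := μ.toSphere.map (↑) with hν
  have : IsFiniteMeasure ν := by rw [hν]; infer_instance
  have hG : ContDiffOn ℝ ∞ (fun q : P × E => χ (-q.2) * g (q.1, -q.2)) (s ×ˢ univ) := by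
    intro q hq
    rcases eq_or_ne q.2 0 with h0 | h0
    · have hnhds : ∀ᶠ q' : P × E in nhds q, χ (-q'.2) * g (q'.1, -q'.2) = 0 := by
        have : ContinuousAt (fun q' : P × E => -q'.2) q := by fun_prop
        have hb : ball (0 : E) (1 / 4) ∈ nhds (-q.2) := by
          rw [h0, neg_zero]; exact ball_mem_nhds _ (by norm_num)
        filter_upwards [this hb] with q' hq'
        rw [hχ0 _ hq', zero_mul]
      exact (contDiffAt_const.congr_of_eventuallyEq hnhds).contDiffWithinAt
    · have hopen : IsOpen (s ×ˢ ({0}ᶜ : Set E)) := hs.prod isOpen_compl_singleton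
      have h1 : ContDiffAt ℝ ∞ g (q.1, -q.2) :=
        hg.contDiffAt (hopen.mem_nhds ⟨hq.1, by simpa using h0⟩)
      have h2 : ContDiffAt ℝ ∞ (fun q : P × E => (q.1, -q.2)) q := by fun_prop
      have h3 : ContDiffAt ℝ ∞ (fun q : P × E => χ (-q.2)) q :=
        hχs.contDiffAt.comp q (contDiffAt_snd.neg)
      exact (h3.mul (h1.comp q h2)).contDiffWithinAt
  have := contDiffOn_convolution_right_with_param_comp (n := ⊤) (μ := ν) (f := fun _ : E => (1 : ℝ))
    (ContinuousLinearMap.lsmul ℝ ℝ)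
    (v := fun _ : P => (0 : E)) contDiffOn_const hs (isCompact_closedBall (0 : E) 3)
    (g := fun p x => χ (-x) * g (p, -x))
    (fun p x _ hx => by
      rw [hχk _ (by simpa using hx), zero_mul]) (integrable_const _).locallyIntegrable hG
  refine this.congr fun p hp => ?_
  rw [MeasureTheory.convolution, hν, integral_map measurable_subtype_coe.aemeasurable]
  · refine integral_congr_ae (Filter.Eventually.of_forall fun u => ?_)
    simp [hχ1 u u.2]
  · refine Continuous.aestronglyMeasurable ?_
    have h1 : Continuous fun x : E => ((p, 0 - x) : P × E) := by fun_prop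
    exact continuous_const.mul (hG.continuousOn.comp_continuous h1 fun x => ⟨hp, mem_univ _⟩)

end Polar

/-! ### Smooth dependence of the Busemann integral on the frame -/

section SmoothIntegral

variable {V : Type*} [NormedAddCommGroup V] [NormedSpace ℝ V] [FiniteDimensional ℝ V] {m : ℕ}

theorem contDiff_toForm {k : ℕ} (b : ⋀[ℝ]^k V) :
    ContDiff ℝ ∞ fun p : Fin k → StrongDual ℝ V => toForm b p := by
  have hb : b ∈ Submodule.span ℝ (range (exteriorPower.ιMulti ℝ k : (Fin k → V) → ⋀[ℝ]^k V)) := by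
    rw [exteriorPower.ιMulti_span]; trivial
  induction hb using Submodule.span_induction with
  | mem x hx =>
    obtain ⟨v, rfl⟩ := hx
    simp only [toForm_ιMulti, Matrix.det_apply, Matrix.of_apply]
    refine ContDiff.sum fun σ _ => ContDiff.const_smul _ (contDiff_prod fun i _ => ?_)
    exact (contDiff_apply ℝ (StrongDual ℝ V) i).clm_apply contDiff_const
  | zero =>
    have h0 : toForm (0 : ⋀[ℝ]^k V) = 0 := by ext p; simp [toForm]
    simp only [h0]
    exact contDiff_const
  | add x y _ _ hx hy =>
    simp only [toForm_add, AlternatingMap.add_apply]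
    exact hx.add hy
  | smul r x _ hx => simpa [toForm_smul] using contDiff_const.mul hx

variable (hV : IsMinkowski V)
include hV

theorem IsMinkowski.contDiffOn_busemannIntegrand (b : ⋀[ℝ]^(m + 1) V) :
    ContDiffOn ℝ ∞ (fun q : (Fin (m + 1) → V) × EuclideanSpace ℝ (Fin (m + 1)) =>
      busemannIntegrand q.1 b q.2) ({v | LinearIndependent ℝ v} ×ˢ {0}ᶜ) := by
  refine (contDiff_toForm b).comp_contDiffOn (contDiffOn_pi.2 fun i => ?_)
  refine ContDiffOn.clm_apply ?_ ((contDiff_apply ℝ V i).comp contDiff_fst).contDiffOn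
  refine hV.contDiffOn_hessian.comp ?_ fun q hq => frameMap_ne_zero hq.1 hq.2
  exact ((contDiff_frameMap.comp contDiff_fst).clm_apply contDiff_snd).contDiffOn

theorem IsMinkowski.busemannIntegrand_smul {v : Fin (m + 1) → V} (hv : LinearIndependent ℝ v)
    (b : ⋀[ℝ]^(m + 1) V) {t : ℝ} (ht : t ≠ 0) {y : EuclideanSpace ℝ (Fin (m + 1))} (hy : y ≠ 0) :
    busemannIntegrand v b (t • y) = busemannIntegrand v b y := by
  rw [busemannIntegrand, map_smul, hV.hessian_smul ht (frameMap_ne_zero hv hy)]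
  rfl

theorem IsMinkowski.continuousOn_busemannIntegrand {v : Fin (m + 1) → V}
    (hv : LinearIndependent ℝ v) (b : ⋀[ℝ]^(m + 1) V) :
    ContinuousOn (busemannIntegrand v b) {0}ᶜ :=
  (hV.contDiffOn_busemannIntegrand b).continuousOn.comp (f := fun y => (v, y))
    (by fun_prop) fun _ hy => ⟨hv, hy⟩

theorem IsMinkowski.busemannIntegral_eq_polar {v : Fin (m + 1) → V} (hv : LinearIndependent ℝ v)
    (b : ⋀[ℝ]^(m + 1) V) :
    busemannIntegral v b = 1 / ((m + 1 : ℕ) : ℝ) *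
      ∫ u : sphere (0 : EuclideanSpace ℝ (Fin (m + 1))) 1,
        busemannIntegrand v b u / ‖frameMap v u‖ ^ (m + 1)
        ∂(volume : Measure (EuclideanSpace ℝ (Fin (m + 1)))).toSphere :=
  polar_setIntegral volume (by simp) (hV.continuousOn_busemannIntegrand hv b) (frameMap v).continuous.norm
    (fun _ hy => norm_pos_iff.2 (frameMap_ne_zero hv hy))
    (fun _ ht _ hy => hV.busemannIntegrand_smul hv b ht.ne' hy)
    (fun t ht y => by rw [map_smul, norm_smul, Real.norm_of_nonneg ht.le])

theorem IsMinkowski.contDiffOn_busemannIntegral (b : ⋀[ℝ]^(m + 1) V) :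
    ContDiffOn ℝ ∞ (fun v : Fin (m + 1) → V => busemannIntegral v b)
      {v | LinearIndependent ℝ v} := by
  refine ContDiffOn.congr (contDiffOn_const.mul
    (contDiffOn_sphere_integral volume (P := Fin (m + 1) → V) isOpen_setOfPred_linearIndependent
      (g := fun q => busemannIntegrand q.1 b q.2 / ‖frameMap q.1 q.2‖ ^ (m + 1)) ?_))
    fun v hv => hV.busemannIntegral_eq_polar hv b
  refine (hV.contDiffOn_busemannIntegrand b).div (ContDiffOn.pow ?_ _) fun q hq =>
    pow_ne_zero _ (norm_ne_zero_iff.2 (frameMap_ne_zero hq.1 hq.2))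
  refine hV.smooth.comp ?_ fun q hq => frameMap_ne_zero hq.1 hq.2
  exact ((contDiff_frameMap.comp contDiff_fst).clm_apply contDiff_snd).contDiffOn

end SmoothIntegral

/-! ### The singular locus -/

section SingularLocus

variable {V : Type*} [NormedAddCommGroup V] [NormedSpace ℝ V] [FiniteDimensional ℝ V]
variable (hV : IsMinkowski V)
include hV

theorem IsMinkowski.hessian_surjective {x : V} (hx : x ≠ 0) : Function.Surjective (hessian x) := by
  have hinj : Function.Injective (hessian x).toLinearMap := by
    rw [injective_iff_map_eq_zero]
    intro w hw
    by_contra hne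
    have h1 := hV.hessian_pos hx hne
    have h2 : hessian x w = 0 := hw
    rw [h2, zero_apply] at h1
    exact lt_irrefl _ h1
  have hfr : Module.finrank ℝ V = Module.finrank ℝ (StrongDual ℝ V) :=
    Subspace.dual_finrank_eq.symm.trans
      (LinearMap.toContinuousLinearMap : (V →ₗ[ℝ] ℝ) ≃ₗ[ℝ] V →L[ℝ] ℝ).finrank_eq
  exact (LinearMap.injective_iff_surjective_of_finrank_eq_finrank hfr).1 hinj

/-- Evaluation at `x` is maximal on the dual sphere at `legendre x`, so velocities kill `x`.
Conversely, write `q` as the Hessian of some `w` and normalize the Legendre image of the line `x + t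
• w`. -/
theorem IsMinkowski.tangentVectors_sphere {x : V} (hx : ‖x‖ = 1) :
    tangentVectors (sphere (0 : StrongDual ℝ V) 1) (legendre x) = {q | q x = 0} := by
  have hx0 : x ≠ 0 := by rintro rfl; simp at hx
  ext q
  constructor
  · rintro ⟨γ, hγ, hS, h0, rfl⟩
    have hd : HasDerivAt γ (deriv γ 0) 0 :=
      (hγ.differentiable (by simp)).differentiableAt.hasDerivAt
    have hdx : HasDerivAt (fun t => γ t x) (deriv γ 0 x) 0 := by
      simpa using hd.clm_apply (hasDerivAt_const (0 : ℝ) x)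
    have hmax : IsLocalMax (fun t => γ t x) 0 := Filter.Eventually.of_forall fun t => by
      simp only [h0, hV.legendre_self, hx]
      refine (le_abs_self _).trans (((γ t).le_opNorm x).trans ?_)
      rw [mem_sphere_zero_iff_norm.1 (hS t), hx]
      norm_num
    exact hmax.hasDerivAt_eq_zero hdx
  · intro hq
    obtain ⟨w, hw⟩ := hV.hessian_surjective hx0 q
    have hq' : q x = 0 := hq
    -- Applying the Hessian at `x` to the line and evaluating at `x` gives the constant `1`, because
    -- `q x = 0`.
    have hne : ∀ t : ℝ, x + t • w ≠ 0 := by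
      intro t ht
      have h1 := congrArg (fun z => hessian x z x) ht
      simp only [map_add, map_smul, add_apply, smul_apply, hV.hessian_self hx0, hw, hq', map_zero,
        zero_apply, hV.legendre_self, hx] at h1
      norm_num at h1
    have hline : ContDiff ℝ ∞ fun t : ℝ => x + t • w := by fun_prop
    have hn : ContDiff ℝ ∞ fun t : ℝ => ‖x + t • w‖ := contDiff_iff_contDiffAt.2 fun t =>
      (hV.contDiffAt_norm (hne t)).comp t hline.contDiffAt
    have hl : ContDiff ℝ ∞ fun t : ℝ => legendre (x + t • w) := contDiff_iff_contDiffAt.2 fun t =>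
      (hV.contDiffAt_legendre (hne t)).comp t hline.contDiffAt
    refine ⟨fun t => ‖x + t • w‖⁻¹ • legendre (x + t • w),
      (hn.inv fun t => norm_ne_zero_iff.2 (hne t)).smul hl, fun t => ?_, ?_, ?_⟩
    · rw [mem_sphere_zero_iff_norm, norm_smul, norm_inv, norm_norm, hV.norm_legendre,
        inv_mul_cancel₀ (norm_ne_zero_iff.2 (hne t))]
    · simp [hx]
    · have hlin : HasDerivAt (fun t : ℝ => x + t • w) w 0 := by
        simpa using ((hasDerivAt_id (0 : ℝ)).smul_const w).const_add x
      have hx' : x + (0 : ℝ) • w ≠ 0 := hne 0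
      have h1 : HasDerivAt (fun t : ℝ => ‖x + t • w‖) 0 0 := by
        have := (hV.differentiableAt_norm hx').hasFDerivAt.comp_hasDerivAt (0 : ℝ) hlin
        -- By Euler's identity and the symmetry of the Hessian, this derivative is `q x`.
        have hz : fderiv ℝ (fun y : V => ‖y‖) (x + (0 : ℝ) • w) w = 0 := by
          have h2 := hV.legendre_eq hx0
          rw [hx, one_smul] at h2
          rw [zero_smul, add_zero, ← h2, ← hV.hessian_self hx0, hV.hessian_symm hx0, hw, hq']
        rw [hz] at this
        exact this
      have h2 : HasDerivAt (fun t : ℝ => legendre (x + t • w)) q 0 := by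
        have := (hV.hasFDerivAt_legendre hx').comp_hasDerivAt (0 : ℝ) hlin
        rw [zero_smul, add_zero, hw] at this
        exact this
      have h3 := (h1.inv (norm_ne_zero_iff.2 hx')).smul h2
      refine h3.deriv.trans ?_
      simp [hx]

/-- The tangent space is the annihilator of `x`. If `x` lies outside the plane, covectors killing
`x` take arbitrary values on `v`; if `x = frameMap v y`, their projections are all orthogonal to
`y`. -/
theorem IsMinkowski.proj_tangentVectors_ne_univ_iff {m : ℕ} {v : Fin (m + 1) → V}
    (hv : LinearIndependent ℝ v) {x : V} (hx : ‖x‖ = 1) :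
    proj v '' tangentVectors (sphere (0 : StrongDual ℝ V) 1) (legendre x) ≠ univ ↔
      x ∈ range (frameMap v) := by
  rw [hV.tangentVectors_sphere hx]
  constructor
  · intro h
    by_contra hxr
    rw [range_frameMap, SetLike.mem_coe] at hxr
    refine h (eq_univ_of_forall fun y => ?_)
    obtain ⟨p, hp⟩ := exists_dual_apply_eq (linearIndependent_finCons.2 ⟨hv, hxr⟩)
      (Fin.cons 0 y : Fin (m + 2) → ℝ)
    refine ⟨p, by simpa using hp 0, ?_⟩
    ext i
    exact (hp i.succ).trans (Fin.cons_succ _ _ i)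
  · rintro ⟨y, rfl⟩ h
    have hy : y ∈ proj v '' {q | q (frameMap v y) = 0} := h ▸ mem_univ y
    obtain ⟨q, hq, hqy⟩ := hy
    have h1 := inner_proj v q y
    have hq' : q (frameMap v y) = 0 := hq
    rw [hqy, hq', inner_self_eq_zero] at h1
    rw [h1, map_zero, norm_zero] at hx
    exact zero_ne_one hx

theorem IsMinkowski.singularLocus_eq {m : ℕ} {a : ⋀[ℝ]^(m + 1) V}
    (hv : LinearIndependent ℝ (frame a)) :
    singularLocus a = legendre '' {x | ‖x‖ = 1 ∧ x ∈ range (frameMap (frame a))} := by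
  ext p
  obtain ⟨x, rfl⟩ := hV.legendre_surjective p
  rw [hV.legendre_injective.mem_set_image, singularLocus, mem_ofPred_eq, mem_sphere_zero_iff_norm,
    hV.norm_legendre, mem_ofPred_eq]
  exact and_congr_right fun hx => hV.proj_tangentVectors_ne_univ_iff hv hx

end SingularLocus

/-! ### Pullbacks of contracted forms to the sphere -/

section SphereCoeff

/-- In the multilinear expansion the terms containing `Z` twice vanish. The induction is over the
set of perturbed slots; its second clause says that once `Z` occupies a slot the other perturbations
have no effect. -/
theorem alternating_add_smul {M : Type*} [AddCommGroup M] [Module ℝ M] {n : ℕ}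
    (η : M [⋀^Fin n]→ₗ[ℝ] ℝ) (X : Fin n → M) (c : Fin n → ℝ) (Z : M) :
    η (fun i => X i + c i • Z) = η X + ∑ i, c i * η (Function.update X i Z) := by
  classical
  have key : ∀ s : Finset (Fin n),
      η (fun i => X i + (if i ∈ s then c i else 0) • Z) =
        η X + ∑ i ∈ s, c i * η (Function.update X i Z) ∧
      ∀ j, j ∉ s → η (Function.update (fun i => X i + (if i ∈ s then c i else 0) • Z) j Z) =
        η (Function.update X j Z) := by
    intro s
    induction s using Finset.induction_on with
    | empty => simp
    | insert j s hj ih =>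
      set Y : Fin n → M := fun i => X i + (if i ∈ s then c i else 0) • Z with hY
      have hYj : Y j = X j := by simp [hY, hj]
      have hup : (fun i => X i + (if i ∈ insert j s then c i else 0) • Z) =
          Function.update Y j (Y j + c j • Z) := by
        ext i
        rcases eq_or_ne i j with rfl | hij
        · simp [hYj]
        · simp [hij, hY]
      rw [hup]
      constructor
      · rw [AlternatingMap.map_update_add, Function.update_eq_self, AlternatingMap.map_update_smul,
          ih.1, ih.2 j hj, Finset.sum_insert hj, smul_eq_mul]
        ring
      · intro l hl
        have hlj : l ≠ j := fun h => hl (h ▸ Finset.mem_insert_self _ _)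
        have hls : l ∉ s := fun h => hl (Finset.mem_insert_of_mem h)
        rw [Function.update_comm hlj.symm, AlternatingMap.map_update_add,
          AlternatingMap.map_update_smul, AlternatingMap.map_update_update _ _ hlj, smul_zero,
          add_zero, ← ih.2 l hls, ← Function.update_of_ne hlj.symm Z Y, Function.update_eq_self]
  simpa using (key Finset.univ).1

variable {m : ℕ} {W : Type*} [NormedAddCommGroup W] [NormedSpace ℝ W]

/-- For `p = f u` and `D` the derivative of `f` at `u`, the right-hand side is `η` on the
differential of the cone extension of `f`. In its expansion the `D u` terms sum to `-(∑ uᵢ²) η X =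
-η X` and cancel the leading term, leaving the `p` terms. -/
theorem sphereCoeff_curryLeft (η : W [⋀^Fin (m + 1)]→ₗ[ℝ] ℝ) (p : W)
    (D : EuclideanSpace ℝ (Fin (m + 1)) →ₗ[ℝ] W) {u : EuclideanSpace ℝ (Fin (m + 1))}
    (hu : ‖u‖ = 1) :
    sphereCoeff ((η.curryLeft p).compLinearMap D) u =
      η fun i => D (EuclideanSpace.single i 1) + u i • (p - D u) := by
  set X : Fin (m + 1) → W := fun i => D (EuclideanSpace.single i 1) with hX
  have hDu : D u = ∑ j, u j • X j := by
    conv_lhs => rw [← (EuclideanSpace.basisFun (Fin (m + 1)) ℝ).sum_repr u]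
    simp [hX]
  have h1 : ∀ i, η (Function.update X i (D u)) = u i * η X := by
    intro i
    rw [hDu, AlternatingMap.map_update_sum, Finset.sum_eq_single i]
    · rw [AlternatingMap.map_update_smul, Function.update_eq_self, smul_eq_mul]
    · intro j _ hj
      rw [AlternatingMap.map_update_smul, AlternatingMap.map_update_self _ _ hj.symm, smul_zero]
    · simp
  have h2 : ∀ i, η (Function.update X i p) =
      (-1) ^ (i : ℕ) * η (Matrix.vecCons p (fun j => X (i.succAbove j))) := by
    intro i
    rw [← Fin.insertNth_removeNth, AlternatingMap.map_insertNth, zsmul_eq_mul]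
    push_cast
    rfl
  have h3 : ∑ i, u i * u i = 1 := by
    have := EuclideanSpace.real_norm_sq_eq u
    rw [hu] at this
    simpa [sq] using this.symm
  refine Eq.trans ?_ (alternating_add_smul η X (fun i => u i) (p - D u)).symm
  simp only [AlternatingMap.map_update_sub, h1, h2, mul_sub, Finset.sum_sub_distrib]
  have h4 : ∑ i, u i * (u i * η X) = η X := by
    simp only [← mul_assoc]
    rw [← Finset.sum_mul, h3, one_mul]
  rw [h4, add_sub_cancel, sphereCoeff]
  refine Finset.sum_congr rfl fun i _ => ?_
  rw [AlternatingMap.compLinearMap_apply, AlternatingMap.curryLeft_apply_apply]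
  ring_nf
  rfl

end SphereCoeff

/-! ### Parametrizations of the singular locus -/

section Param

variable {V : Type*} [NormedAddCommGroup V] [NormedSpace ℝ V] {m : ℕ}

/-- The image under the Legendre map of the unit sphere of the plane spanned by `v`. -/
def legendreSphere (v : Fin (m + 1) → V) : Set (StrongDual ℝ V) :=
  legendre '' {x | ‖x‖ = 1 ∧ x ∈ range (frameMap v)}

/-- The radial parametrization of `legendreSphere v`. -/
noncomputable def legendreParam (v : Fin (m + 1) → V) (u : EuclideanSpace ℝ (Fin (m + 1))) :
    StrongDual ℝ V :=
  ‖frameMap v u‖⁻¹ • legendre (frameMap v u)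

theorem hasFDerivAt_norm_of_norm_eq_one {E : Type*} [NormedAddCommGroup E] [InnerProductSpace ℝ E]
    {u : E} (hu : ‖u‖ = 1) : HasFDerivAt (fun y : E => ‖y‖) (innerSL ℝ u) u := by
  have h := (hasStrictFDerivAt_norm_sq u).hasFDerivAt.sqrt (by rw [hu]; norm_num)
  simp only [Real.sqrt_sq (norm_nonneg _), hu] at h
  refine h.congr_fderiv ?_
  ext w
  simp

/-- The extension of a map on the sphere to a homogeneous map of degree one. -/
noncomputable def coneExtension {E W : Type*} [NormedAddCommGroup E] [NormedSpace ℝ E]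
    [NormedAddCommGroup W] [NormedSpace ℝ W] (f : E → W) (y : E) : W :=
  ‖y‖ • f (‖y‖⁻¹ • y)

/-! ### Calculus of the cone extension of a map on the sphere -/

section Cone

variable {E W : Type*} [NormedAddCommGroup E] [InnerProductSpace ℝ E]
  [NormedAddCommGroup W] [NormedSpace ℝ W] {f : E → W}

theorem coneExtension_of_norm_eq_one {u : E} (hu : ‖u‖ = 1) : coneExtension f u = f u := by
  simp [coneExtension, hu]

theorem coneExtension_smul {t : ℝ} (ht : 0 < t) (y : E) :
    coneExtension f (t • y) = t • coneExtension f y := by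
  rw [coneExtension, coneExtension, norm_smul, Real.norm_of_nonneg ht.le, mul_smul, mul_inv,
    smul_smul _ t y, mul_right_comm, inv_mul_cancel₀ ht.ne', one_mul]

theorem contDiffOn_coneExtension (hf : ContDiffOn ℝ ∞ f {0}ᶜ) :
    ContDiffOn ℝ ∞ (coneExtension f) {0}ᶜ := by
  have hn : ContDiffOn ℝ ∞ (fun y : E => ‖y‖) {0}ᶜ := fun y hy =>
    (contDiffAt_norm ℝ hy).contDiffWithinAt
  refine hn.smul (hf.comp ((hn.inv fun y hy => norm_ne_zero_iff.2 hy).smul contDiffOn_id)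
    fun y hy => ?_)
  exact smul_ne_zero (inv_ne_zero (norm_ne_zero_iff.2 hy)) hy

theorem hasFDerivAt_coneExtension (hf : ContDiffOn ℝ ∞ f {0}ᶜ) {y : E} (hy : y ≠ 0) :
    HasFDerivAt (coneExtension f) (fderiv ℝ (coneExtension f) y) y :=
  (((contDiffOn_coneExtension hf).contDiffAt
    (isOpen_compl_singleton.mem_nhds hy)).differentiableAt (by simp)).hasFDerivAt

theorem fderiv_coneExtension_smul (hf : ContDiffOn ℝ ∞ f {0}ᶜ) {t : ℝ} (ht : 0 < t) {y : E}
    (hy : y ≠ 0) : fderiv ℝ (coneExtension f) (t • y) = fderiv ℝ (coneExtension f) y := by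
  have h1 : HasFDerivAt (fun z : E => coneExtension f (t • z))
      (fderiv ℝ (coneExtension f) (t • y) ∘L (t • ContinuousLinearMap.id ℝ E)) y :=
    (hasFDerivAt_coneExtension hf (smul_ne_zero ht.ne' hy)).comp y
      ((hasFDerivAt_id y).const_smul t)
  have h2 : HasFDerivAt (fun z : E => coneExtension f (t • z))
      (t • fderiv ℝ (coneExtension f) y) y := by
    simp only [coneExtension_smul ht]
    exact (hasFDerivAt_coneExtension hf hy).const_smul t
  have h := h1.unique h2
  ext w
  have := congrArg (fun L => L w) h
  simpa [ht.ne'] using this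

theorem fderiv_coneExtension_apply (hf : ContDiffOn ℝ ∞ f {0}ᶜ) {u : E} (hu : ‖u‖ = 1) (w : E) :
    fderiv ℝ (coneExtension f) u w = fderiv ℝ f u w + inner ℝ u w • (f u - fderiv ℝ f u u) := by
  have hu0 : u ≠ 0 := by rintro rfl; simp at hu
  have hn := hasFDerivAt_norm_of_norm_eq_one hu
  have hi : HasFDerivAt (fun y : E => ‖y‖⁻¹) _ u :=
    (hasDerivAt_inv (norm_ne_zero_iff.2 hu0)).comp_hasFDerivAt u hn
  have hs := hi.smul (hasFDerivAt_id u)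
  have hfd : HasFDerivAt f (fderiv ℝ f u) (((fun y : E => ‖y‖⁻¹) • (id : E → E)) u) := by
    have : ((fun y : E => ‖y‖⁻¹) • (id : E → E)) u = u := by simp [hu]
    rw [this]
    exact ((hf.contDiffAt (isOpen_compl_singleton.mem_nhds hu0)).differentiableAt
      (by simp)).hasFDerivAt
  have h := hn.smul (hfd.comp u hs)
  have h' : HasFDerivAt (coneExtension f) _ u := h
  rw [h'.fderiv]
  simp [hu, smul_sub]
  module

end Cone

variable [FiniteDimensional ℝ V]

/-- On the cone over the image of `f` the radial direction is the Euler field, so the contracted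
form on the sphere becomes the full form on the cone. -/
theorem sphereCoeff_pullback_eulerContraction {f : EuclideanSpace ℝ (Fin (m + 1)) → StrongDual ℝ V}
    (hf : ContDiffOn ℝ ∞ f {0}ᶜ) (b : ⋀[ℝ]^(m + 1) V) {u : EuclideanSpace ℝ (Fin (m + 1))}
    (hu : ‖u‖ = 1) :
    sphereCoeff (pullback f (eulerContraction b) u) u =
      toForm b fun i => fderiv ℝ (coneExtension f) u (EuclideanSpace.single i 1) := by
  rw [pullback, eulerContraction, sphereCoeff_curryLeft _ _ _ hu]
  congr 1
  ext1 i
  rw [fderiv_coneExtension_apply hf hu]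
  simp [EuclideanSpace.inner_single_right]

variable (hV : IsMinkowski V)
include hV

omit [FiniteDimensional ℝ V] in
theorem IsMinkowski.contDiffOn_legendreParam {v : Fin (m + 1) → V} (hv : LinearIndependent ℝ v) :
    ContDiffOn ℝ ∞ (legendreParam v) {0}ᶜ := by
  have h1 : MapsTo (frameMap v) {0}ᶜ {0}ᶜ := fun y hy => frameMap_ne_zero hv hy
  exact ((hV.smooth.comp (frameMap v).contDiff.contDiffOn h1).inv
    fun y hy => norm_ne_zero_iff.2 (h1 hy)).smul
    (hV.contDiffOn_legendre.comp (frameMap v).contDiff.contDiffOn h1)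

omit [FiniteDimensional ℝ V] in
theorem IsMinkowski.legendreParam_eq (v : Fin (m + 1) → V) (u : EuclideanSpace ℝ (Fin (m + 1))) :
    legendreParam v u = legendre (frameMap v (‖frameMap v u‖⁻¹ • u)) := by
  rw [map_smul, hV.legendre_smul]; rfl

theorem IsMinkowski.bijOn_legendreParam {v : Fin (m + 1) → V} (hv : LinearIndependent ℝ v) :
    BijOn (legendreParam v) (sphere 0 1) (legendreSphere v) := by
  have hne : ∀ u ∈ sphere (0 : EuclideanSpace ℝ (Fin (m + 1))) 1, ‖frameMap v u‖ ≠ 0 :=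
    fun u hu => norm_ne_zero_iff.2 (frameMap_ne_zero hv (ne_zero_of_mem_unit_sphere ⟨u, hu⟩))
  refine ⟨fun u hu => ?_, fun u hu u' hu' h => ?_, ?_⟩
  · rw [hV.legendreParam_eq]
    refine ⟨_, ⟨?_, mem_range_self _⟩, rfl⟩
    rw [map_smul, norm_smul, norm_inv, norm_norm, inv_mul_cancel₀ (hne u hu)]
  · rw [hV.legendreParam_eq, hV.legendreParam_eq] at h
    have h1 := frameMap_injective hv (hV.legendre_injective h)
    have h2 := congrArg norm h1
    rw [norm_smul, norm_smul, mem_sphere_zero_iff_norm.1 hu, mem_sphere_zero_iff_norm.1 hu',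
      norm_inv, norm_inv, norm_norm, norm_norm, mul_one, mul_one] at h2
    rw [h2] at h1
    exact smul_right_injective _ (inv_ne_zero (hne u' hu')) h1
  · rintro _ ⟨x, ⟨hx, y, rfl⟩, rfl⟩
    have hy : y ≠ 0 := by rintro rfl; simp at hx
    refine ⟨‖y‖⁻¹ • y, by simp [norm_smul, hy], ?_⟩
    rw [legendreParam, map_smul, norm_smul, hx, hV.legendre_smul, smul_smul]
    simp [hy]

/-- The cone extension of the radial parametrization has differential at `u` equal to that of
`legendre ∘ frameMap v`, preceded by `N⁻¹` times a transvection along `u`; the transvection has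
determinant `1`. -/
theorem IsMinkowski.sphereCoeff_legendreParam {v : Fin (m + 1) → V} (hv : LinearIndependent ℝ v)
    (b : ⋀[ℝ]^(m + 1) V) {u : EuclideanSpace ℝ (Fin (m + 1))} (hu : ‖u‖ = 1) :
    sphereCoeff (pullback (legendreParam v) (eulerContraction b) u) u =
      (‖frameMap v u‖⁻¹) ^ (m + 1) * busemannIntegrand v b u := by
  have hu0 : u ≠ 0 := by rintro rfl; simp at hu
  have hx0 : frameMap v u ≠ 0 := frameMap_ne_zero hv hu0
  set N := ‖frameMap v u‖ with hN
  have hN0 : N ≠ 0 := norm_ne_zero_iff.2 hx0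
  set φ : StrongDual ℝ (EuclideanSpace ℝ (Fin (m + 1))) :=
    (fderiv ℝ (fun y : V => ‖y‖) (frameMap v u)).comp (frameMap v) with hφ
  have hn : HasFDerivAt (fun y => ‖frameMap v y‖) φ u :=
    (hV.differentiableAt_norm hx0).hasFDerivAt.comp u (frameMap v).hasFDerivAt
  have hφu : φ u = N := (hV.differentiableAt_norm hx0).fderiv_norm_self
  have hl : HasFDerivAt (fun y => legendre (frameMap v y))
      ((hessian (frameMap v u)).comp (frameMap v)) u :=
    (hV.hasFDerivAt_legendre hx0).comp u (frameMap v).hasFDerivAt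
  have hfd : ∀ w, fderiv ℝ (legendreParam v) u w =
      N⁻¹ • hessian (frameMap v u) (frameMap v (w - (N⁻¹ * φ w) • u)) := by
    intro w
    have hi : HasFDerivAt (fun y => ‖frameMap v y‖⁻¹) _ u :=
      (hasDerivAt_inv hN0).comp_hasFDerivAt u hn
    have h : HasFDerivAt (legendreParam v) _ u := hi.smul hl
    rw [h.fderiv]
    simp only [map_sub, map_smul, hV.hessian_self hx0, ← hN, add_apply, smul_apply,
      ContinuousLinearMap.smulRight_apply, ContinuousLinearMap.comp_apply, smul_eq_mul]
    match_scalars <;> field_simp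
  set ψ : StrongDual ℝ (EuclideanSpace ℝ (Fin (m + 1))) := innerSL ℝ u - N⁻¹ • φ with hψ
  have hψu : ψ u = 0 := by
    simp [hψ, hφu, hN0, hu]
  have hT : ∀ w, fderiv ℝ (coneExtension (legendreParam v)) u w =
      ((hessian (frameMap v u)).comp (frameMap v)).toLinearMap
        ((N⁻¹ • LinearMap.transvection ψ.toLinearMap u) w) := by
    intro w
    have h0 : fderiv ℝ (legendreParam v) u u = 0 := by
      rw [hfd, hφu, inv_mul_cancel₀ hN0, one_smul, sub_self, map_zero, map_zero, smul_zero]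
    rw [fderiv_coneExtension_apply (hV.contDiffOn_legendreParam hv) hu, h0, sub_zero, hfd,
      legendreParam, ← hV.hessian_self hx0]
    simp only [LinearMap.smul_apply, LinearMap.transvection.apply, ContinuousLinearMap.coe_coe,
      ContinuousLinearMap.comp_apply, ← map_smul, ← map_add, hψ, sub_apply, smul_apply,
      innerSL_apply_apply, smul_eq_mul, ← hN]
    congr 2
    module
  rw [sphereCoeff_pullback_eulerContraction (hV.contDiffOn_legendreParam hv) b hu]
  simp only [hT]
  rw [alternating_comp_euclidean, LinearMap.det_smul, LinearMap.transvection.det]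
  simp [hψu, busemannIntegrand]

theorem IsMinkowski.isOrientedParam_legendreParam {v : Fin (m + 1) → V}
    (hv : LinearIndependent ℝ v) :
    IsOrientedParam (legendreSphere v) (eulerContraction (exteriorPower.ιMulti ℝ (m + 1) v))
      (legendreParam v) where
  smooth := hV.contDiffOn_legendreParam hv
  bijOn := hV.bijOn_legendreParam hv
  oriented u hu := by
    have hu0 : u ≠ 0 := ne_zero_of_mem_unit_sphere ⟨u, hu⟩
    rw [hV.sphereCoeff_legendreParam hv _ (mem_sphere_zero_iff_norm.1 hu)]
    have := norm_pos_iff.2 (frameMap_ne_zero hv hu0)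
    exact mul_pos (by positivity) (hV.busemannIntegrand_self_pos hv hu0)

/-- Integrals over the singular locus do not depend on the parametrization. -/
theorem IsMinkowski.sphereIntegral_eq {v : Fin (m + 1) → V} (hv : LinearIndependent ℝ v)
    {f : EuclideanSpace ℝ (Fin (m + 1)) → StrongDual ℝ V}
    (hf : IsOrientedParam (legendreSphere v)
      (eulerContraction (exteriorPower.ιMulti ℝ (m + 1) v)) f) (b : ⋀[ℝ]^(m + 1) V) :
    sphereIntegral (pullback f (eulerContraction b)) = ((m + 1 : ℕ) : ℝ) * busemannIntegral v b := by
  set a := exteriorPower.ιMulti ℝ (m + 1) v with ha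
  set F := coneExtension f with hF
  have hnorm : ∀ y : EuclideanSpace ℝ (Fin (m + 1)), y ≠ 0 →
      ‖y‖⁻¹ • y ∈ sphere (0 : EuclideanSpace ℝ (Fin (m + 1))) 1 := fun y hy => by
    simp [norm_smul, hy]
  have hex : ∀ y : EuclideanSpace ℝ (Fin (m + 1)), ∃ z : EuclideanSpace ℝ (Fin (m + 1)),
      y ≠ 0 → F y = legendre (frameMap v z) ∧ ‖frameMap v z‖ = ‖y‖ := by
    intro y
    by_cases hy : y = 0
    · exact ⟨0, fun h => (h hy).elim⟩
    obtain ⟨x, ⟨hx, z, rfl⟩, he⟩ := hf.bijOn.mapsTo (hnorm y hy)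
    refine ⟨‖y‖ • z, fun _ => ⟨?_, ?_⟩⟩
    · rw [map_smul, hV.legendre_smul, he]; rfl
    · rw [map_smul, norm_smul, hx, norm_norm, mul_one]
  -- The transition map: the cone extension `F` of `f` equals `legendre ∘ frameMap v ∘ g` off the
  -- origin, so integrals for `f` reduce to a change of variables by `g`.
  choose g hg using hex
  have hg0 : ∀ y, y ≠ 0 → g y ≠ 0 := fun y hy h => by
    have := (hg y hy).2
    rw [h, map_zero, norm_zero] at this
    exact hy (norm_eq_zero.1 this.symm)
  -- Near `y`, `g` is `proj v ∘ F` followed by a local inverse of `legendreProj v v`, whose Jacobian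
  -- is positive; global injectivity identifies the two.
  have hd : ∀ y, y ≠ 0 → ∃ g' : EuclideanSpace ℝ (Fin (m + 1)) →L[ℝ] EuclideanSpace ℝ (Fin (m + 1)),
      HasFDerivAt g g' y := by
    intro y hy
    have hz := hg0 y hy
    have hdet : ((proj v).comp ((hessian (frameMap v (g y))).comp (frameMap v))).det ≠ 0 := by
      rw [det_fderiv_legendreProj]
      exact (hV.busemannIntegrand_self_pos hv hz).ne'
    have hcd : ContDiffAt ℝ ∞ (legendreProj v v) (g y) :=
      (proj v).contDiff.contDiffAt.comp _ ((hV.contDiffAt_legendre (frameMap_ne_zero hv hz)).comp _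
        (frameMap v).contDiff.contDiffAt)
    have hstrict := hcd.hasStrictFDerivAt (by simp)
    rw [(hV.hasFDerivAt_legendreProj hv v hz).fderiv,
      ← ContinuousLinearMap.coe_toContinuousLinearEquivOfDetNeZero _ hdet] at hstrict
    have hH : HasFDerivAt (fun y => proj v (F y)) ((proj v).comp (fderiv ℝ F y)) y :=
      (proj v).hasFDerivAt.comp y (hasFDerivAt_coneExtension hf.smooth hy)
    have hHy : ∀ y, y ≠ 0 → proj v (F y) = legendreProj v v (g y) := fun y hy => by
      rw [(hg y hy).1]; rfl
    have hright := hstrict.eventually_right_inverse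
    have hinv := hstrict.to_localInverse.hasFDerivAt
    rw [← hHy y hy] at hright hinv
    refine ⟨_, (hinv.comp y hH).congr_of_eventuallyEq ?_⟩
    filter_upwards [hH.continuousAt.eventually hright, isOpen_compl_singleton.mem_nhds hy]
      with z h1 h2
    rw [hHy z h2] at h1
    exact (hV.legendreProj_self_injective hv (by rw [Function.comp_apply, hHy z h2, h1])).symm
  have hd' : ∀ y, y ≠ 0 → HasFDerivAt g (fderiv ℝ g y) y := fun y hy => by
    obtain ⟨g', h⟩ := hd y hy
    exact h.differentiableAt.hasFDerivAt
  have hform : ∀ (c : ⋀[ℝ]^(m + 1) V) (y), y ≠ 0 →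
      toForm c (fun i => fderiv ℝ F y (EuclideanSpace.single i 1)) =
        (fderiv ℝ g y).det * busemannIntegrand v c (g y) := by
    intro c y hy
    have h1 : HasFDerivAt F
        (((hessian (frameMap v (g y))).comp (frameMap v)).comp (fderiv ℝ g y)) y := by
      have h2 := ((hV.hasFDerivAt_legendre (frameMap_ne_zero hv (hg0 y hy))).comp (g y)
        (frameMap v).hasFDerivAt).comp y (hd' y hy)
      refine h2.congr_of_eventuallyEq ?_
      filter_upwards [isOpen_compl_singleton.mem_nhds hy] with z hz
      exact (hg z hz).1
    rw [h1.fderiv]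
    refine (alternating_comp_euclidean (toForm c)
      ((hessian (frameMap v (g y))).comp (frameMap v)).toLinearMap
      (fderiv ℝ g y).toLinearMap).trans ?_
    simp [busemannIntegrand, ContinuousLinearMap.det]
  have hhom : ∀ (c : ⋀[ℝ]^(m + 1) V) (t : ℝ), 0 < t → ∀ y, y ≠ 0 →
      toForm c (fun i => fderiv ℝ F (t • y) (EuclideanSpace.single i 1)) =
        toForm c (fun i => fderiv ℝ F y (EuclideanSpace.single i 1)) := by
    intro c t ht y hy
    rw [hF, fderiv_coneExtension_smul hf.smooth ht hy]
  -- This is where the orientation of `f` enters: the form `a` is positive both on `F` and on the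
  -- Legendre image of the plane.
  have hpos : ∀ y, y ≠ 0 → 0 < (fderiv ℝ g y).det := by
    intro y hy
    have h1 := hf.oriented _ (hnorm y hy)
    rw [sphereCoeff_pullback_eulerContraction hf.smooth _ (mem_sphere_zero_iff_norm.1 (hnorm y hy)),
      ← hF, hhom _ _ (inv_pos.2 (norm_pos_iff.2 hy)) _ hy, hform _ _ hy] at h1
    exact (pos_iff_pos_of_mul_pos h1).2 (hV.busemannIntegrand_self_pos hv (hg0 y hy))
  have himage : g '' {y | y ≠ 0 ∧ ‖y‖ ≤ 1} = puncturedBall v := by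
    ext z
    constructor
    · rintro ⟨y, hy, rfl⟩
      exact ⟨hg0 y hy.1, (hg y hy.1).2.trans_le hy.2⟩
    · intro hz
      have hx := frameMap_ne_zero hv hz.1
      have hx' : ‖frameMap v z‖ ≠ 0 := norm_ne_zero_iff.2 hx
      obtain ⟨u, hu, hue⟩ := hf.bijOn.surjOn (⟨frameMap v (‖frameMap v z‖⁻¹ • z),
        ⟨by rw [map_smul, norm_smul, norm_inv, norm_norm, inv_mul_cancel₀ hx'], mem_range_self _⟩,
        rfl⟩ : legendre (frameMap v (‖frameMap v z‖⁻¹ • z)) ∈ legendreSphere v)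
      have hu1 := mem_sphere_zero_iff_norm.1 hu
      have hy0 : ‖frameMap v z‖ • u ≠ 0 :=
        smul_ne_zero hx' (ne_zero_of_mem_unit_sphere ⟨u, hu⟩)
      refine ⟨‖frameMap v z‖ • u, ⟨hy0, ?_⟩, ?_⟩
      · rw [norm_smul, norm_norm, hu1, mul_one]; exact hz.2
      · have h1 := (hg _ hy0).1
        rw [hF, coneExtension_smul (norm_pos_iff.2 hx), coneExtension_of_norm_eq_one hu1, hue,
          map_smul, hV.legendre_smul, smul_smul, mul_inv_cancel₀ hx', one_smul] at h1
        exact (frameMap_injective hv (hV.legendre_injective h1)).symm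
  have hinj : InjOn g {y | y ≠ 0 ∧ ‖y‖ ≤ 1} := by
    intro y hy z hz hyz
    have hn : ‖y‖ = ‖z‖ := by rw [← (hg y hy.1).2, ← (hg z hz.1).2, hyz]
    have h1 : F y = F z := by rw [(hg y hy.1).1, (hg z hz.1).1, hyz]
    rw [hF, coneExtension, coneExtension, ← hn] at h1
    have h2 := smul_right_injective _ (norm_ne_zero_iff.2 hy.1) h1
    have hz' := hnorm z hz.1
    rw [← hn] at hz'
    exact smul_right_injective _ (inv_ne_zero (norm_ne_zero_iff.2 hy.1))
      (hf.bijOn.injOn (hnorm y hy.1) hz' h2)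
  have hmeas : MeasurableSet {y : EuclideanSpace ℝ (Fin (m + 1)) | y ≠ 0 ∧ ‖y‖ ≤ 1} :=
    (measurableSet_singleton 0).compl.inter
      (isClosed_le continuous_norm continuous_const).measurableSet
  have hcont : ContinuousOn (fun y => toForm b fun i =>
      fderiv ℝ F y (EuclideanSpace.single i 1)) {0}ᶜ := by
    refine (continuous_toForm b).comp_continuousOn (continuousOn_pi.2 fun i => ?_)
    exact ((contDiffOn_coneExtension hf.smooth).continuousOn_fderiv_of_isOpen
      isOpen_compl_singleton (by simp)).clm_apply continuousOn_const
  have hpolar := polar_setIntegral (volume : Measure (EuclideanSpace ℝ (Fin (m + 1))))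
    (by simp : Module.finrank ℝ (EuclideanSpace ℝ (Fin (m + 1))) = m + 1) hcont
    continuous_norm (fun y hy => norm_pos_iff.2 hy) (hhom b)
    (fun t ht y => by rw [norm_smul, Real.norm_of_nonneg ht.le])
  have hchange := integral_image_eq_integral_abs_det_fderiv_smul volume hmeas
    (fun y hy => (hd' y hy.1).hasFDerivWithinAt) hinj (busemannIntegrand v b)
  rw [himage] at hchange
  have h1 : busemannIntegral v b = ∫ y in {y | y ≠ 0 ∧ ‖y‖ ≤ 1},
      toForm b fun i => fderiv ℝ F y (EuclideanSpace.single i 1) := by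
    rw [busemannIntegral, hchange]
    refine setIntegral_congr_fun hmeas fun y hy => ?_
    simp only [hform b y hy.1, abs_of_pos (hpos y hy.1), smul_eq_mul]
  have h2 : ((m + 1 : ℕ) : ℝ) ≠ 0 := by positivity
  rw [h1, hpolar, ← mul_assoc, mul_one_div_cancel h2, one_mul, sphereIntegral]
  refine integral_congr_ae (Filter.Eventually.of_forall fun u => ?_)
  have hu1 : ‖(u : EuclideanSpace ℝ (Fin (m + 1)))‖ = 1 := mem_sphere_zero_iff_norm.1 u.2
  simp only [hu1, one_pow, div_one]
  exact sphereCoeff_pullback_eulerContraction hf.smooth b hu1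

/-- The radial parametrization shows that the default value `0` of `formIntegral` is not used, and
`sphereIntegral_eq` applies to whichever parametrization was chosen. -/
theorem IsMinkowski.busemannValue_frame {a : ⋀[ℝ]^(m + 1) V} (ha : a ∈ grassmannCone (m + 1) V)
    (ha0 : a ≠ 0) (b : ⋀[ℝ]^(m + 1) V) :
    busemannValue a b = 1 / ballVolume (m + 1) * busemannIntegral (frame a) b := by
  have hfa := ιMulti_frame ha
  have hv : LinearIndependent ℝ (frame a) := ιMulti_ne_zero_iff.1 (by rwa [hfa])
  have hsing : singularLocus a = legendreSphere (frame a) := hV.singularLocus_eq hv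
  have hparam := hV.isOrientedParam_legendreParam hv
  rw [hfa] at hparam
  have hex : ∃ f, IsOrientedParam (legendreSphere (frame a)) (eulerContraction a) f := ⟨_, hparam⟩
  have hch := hex.choose_spec
  have h := hV.sphereIntegral_eq hv (f := hex.choose) (by rwa [hfa]) b
  rw [busemannValue, formIntegral, hsing, dif_pos hex, h]
  have h2 : ((m + 1 : ℕ) : ℝ) ≠ 0 := by positivity
  rw [one_div_mul_eq_div, one_div_mul_eq_div, mul_div_mul_left _ _ h2]

end Param

/-! ### The Holmes–Thompson density and the Busemann form in an arbitrary frame -/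

section Main

variable {V : Type*} [NormedAddCommGroup V] [NormedSpace ℝ V] [FiniteDimensional ℝ V] {m : ℕ}

theorem ballVolume_pos (k : ℕ) : 0 < ballVolume k :=
  ENNReal.toReal_pos (measure_ball_pos _ _ one_pos).ne' measure_ball_lt_top.ne

theorem smul_mem_grassmannCone {a : ⋀[ℝ]^(m + 1) V} (ha : a ∈ grassmannCone (m + 1) V) (t : ℝ) :
    t • a ∈ grassmannCone (m + 1) V := by
  obtain ⟨w, rfl⟩ := ha
  exact ⟨Function.update w 0 (t • w 0), by
    rw [AlternatingMap.map_update_smul, Function.update_eq_self]⟩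

theorem linearIndependent_frame {a : ⋀[ℝ]^(m + 1) V} (ha : a ∈ grassmannCone (m + 1) V)
    (ha0 : a ≠ 0) : LinearIndependent ℝ (frame a) :=
  ιMulti_ne_zero_iff.1 (by rwa [ιMulti_frame ha])

theorem zero_mem_grassmannCone : (0 : ⋀[ℝ]^(m + 1) V) ∈ grassmannCone (m + 1) V :=
  ⟨0, AlternatingMap.map_zero _⟩

theorem density_zero : density (0 : ⋀[ℝ]^(m + 1) V) = 0 := by
  rw [density, volume_proj_eq_zero, mul_zero]
  rw [← ιMulti_ne_zero_iff, ιMulti_frame zero_mem_grassmannCone]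
  exact fun h => h rfl

theorem density_pos {a : ⋀[ℝ]^(m + 1) V} (ha : a ∈ grassmannCone (m + 1) V) (ha0 : a ≠ 0) :
    0 < density a :=
  mul_pos (one_div_pos.2 (ballVolume_pos _)) (volume_proj_pos (linearIndependent_frame ha ha0))

/-- The frame chosen by `frame` is arbitrary, but it differs from `w` by a matrix of determinant
`t`, which scales the volume by `|t|`. -/
theorem density_eq_of_ιMulti_eq_smul {w : Fin (m + 1) → V} (hw : LinearIndependent ℝ w) {t : ℝ}
    (ht : t ≠ 0) :
    density (t • exteriorPower.ιMulti ℝ (m + 1) w) =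
      |t| * (1 / ballVolume (m + 1) * volume.real (proj w '' closedBall (0 : StrongDual ℝ V) 1)) := by
  have hfr := ιMulti_frame (smul_mem_grassmannCone
    (mem_range_self w : exteriorPower.ιMulti ℝ (m + 1) w ∈ grassmannCone (m + 1) V) t)
  obtain ⟨A, hA, hAw⟩ := exists_matrix_of_ιMulti_eq_smul hw hfr ht
  rw [density, hAw, volume_proj_matrix, hA]
  ring

theorem density_ιMulti {w : Fin (m + 1) → V} (hw : LinearIndependent ℝ w) :
    density (exteriorPower.ιMulti ℝ (m + 1) w) =
      1 / ballVolume (m + 1) * volume.real (proj w '' closedBall (0 : StrongDual ℝ V) 1) := by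
  simpa using density_eq_of_ιMulti_eq_smul hw (one_ne_zero (α := ℝ))

theorem density_smul {a : ⋀[ℝ]^(m + 1) V} (ha : a ∈ grassmannCone (m + 1) V) (t : ℝ) :
    density (t • a) = |t| * density a := by
  rcases eq_or_ne t 0 with rfl | ht
  · simp [density_zero]
  rcases eq_or_ne a 0 with rfl | ha0
  · simp [density_zero]
  obtain ⟨w, rfl⟩ := ha
  have hw := ιMulti_ne_zero_iff.1 ha0
  rw [density_eq_of_ιMulti_eq_smul hw ht, density_ιMulti hw]

variable (hV : IsMinkowski V)
include hV

theorem IsMinkowski.busemannForm_smul_ιMulti {w : Fin (m + 1) → V} (hw : LinearIndependent ℝ w)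
    {t : ℝ} (ht : t ≠ 0) (b : ⋀[ℝ]^(m + 1) V) :
    |t| * busemannForm (t • exteriorPower.ιMulti ℝ (m + 1) w) b =
      t * (1 / ballVolume (m + 1) * busemannIntegral w b) := by
  have hmem := smul_mem_grassmannCone
    (mem_range_self w : exteriorPower.ιMulti ℝ (m + 1) w ∈ grassmannCone (m + 1) V) t
  obtain ⟨A, hA, hAw⟩ := exists_matrix_of_ιMulti_eq_smul hw (ιMulti_frame hmem) ht
  have h0 : t • exteriorPower.ιMulti ℝ (m + 1) w ≠ 0 := smul_ne_zero ht (ιMulti_ne_zero_iff.2 hw)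
  have h1 := busemannIntegral_matrix (A := A) (by rwa [hA]) w b
  change |t| * busemannValue _ b = _
  rw [hV.busemannValue_frame hmem h0, hAw]
  rw [hA] at h1
  linear_combination (1 / ballVolume (m + 1)) * h1

theorem IsMinkowski.busemannForm_ιMulti {w : Fin (m + 1) → V} (hw : LinearIndependent ℝ w)
    (b : ⋀[ℝ]^(m + 1) V) :
    busemannForm (exteriorPower.ιMulti ℝ (m + 1) w) b =
      1 / ballVolume (m + 1) * busemannIntegral w b := by
  simpa using hV.busemannForm_smul_ιMulti hw (one_ne_zero (α := ℝ)) b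

theorem IsMinkowski.busemannForm_self {a : ⋀[ℝ]^(m + 1) V} (ha : a ∈ grassmannCone (m + 1) V)
    (ha0 : a ≠ 0) : busemannForm a a = density a := by
  obtain ⟨w, rfl⟩ := ha
  have hw := ιMulti_ne_zero_iff.1 ha0
  rw [hV.busemannForm_ιMulti hw, hV.busemannIntegral_self hw, density_ιMulti hw]

theorem IsMinkowski.density_smul_busemannForm_smul {a : ⋀[ℝ]^(m + 1) V}
    (ha : a ∈ grassmannCone (m + 1) V) (t : ℝ) :
    density (t • a) • busemannForm (t • a) = t • density a • busemannForm a := by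
  rcases eq_or_ne t 0 with rfl | ht
  · simp [density_zero]
  rcases eq_or_ne a 0 with rfl | ha0
  · simp [density_zero]
  rw [density_smul ha]
  obtain ⟨w, rfl⟩ := ha
  have hw := ιMulti_ne_zero_iff.1 ha0
  refine ContinuousLinearMap.ext fun b => ?_
  have h1 := hV.busemannForm_smul_ιMulti hw ht b
  have h2 := hV.busemannForm_ιMulti hw b
  rw [← h2] at h1
  simp only [smul_apply, smul_eq_mul]
  linear_combination density (exteriorPower.ιMulti ℝ (m + 1) w) * h1

/-- `frame` need not be continuous; near `a` it is replaced by `localFrame`, smooth on an open set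
of the ambient space, and the values of the form on a basis then extend smoothly off the cone. -/
theorem IsMinkowski.smoothOnSubset_busemannForm :
    SmoothOnSubset (busemannForm : ⋀[ℝ]^(m + 1) V → StrongDual ℝ (⋀[ℝ]^(m + 1) V))
      (grassmannCone (m + 1) V \ {0}) := by
  rintro a ⟨ha, ha0⟩
  obtain ⟨q, hq⟩ := exists_toForm_ne_zero (linearIndependent_frame ha ha0)
  rw [ιMulti_frame ha] at hq
  have hsmooth := contDiffOn_localFrame (V := V) (m := m) q
  -- Off the cone the local frame may be dependent, so independence is imposed as an open condition.
  set U : Set (⋀[ℝ]^(m + 1) V) :=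
    {a | toForm a q ≠ 0} ∩ localFrame q ⁻¹' {v | LinearIndependent ℝ v} with hU
  have hUo : IsOpen U := hsmooth.continuousOn.isOpen_inter_preimage (isOpen_toForm_ne_zero q)
    isOpen_setOfPred_linearIndependent
  refine ⟨U, hUo, ⟨hq, ιMulti_ne_zero_iff.1 ?_⟩, fun a => ∑ l,
    (1 / ballVolume (m + 1) * busemannIntegral (localFrame q a)
      (Module.finBasis ℝ (⋀[ℝ]^(m + 1) V) l)) •
      LinearMap.toContinuousLinearMap ((Module.finBasis ℝ (⋀[ℝ]^(m + 1) V)).coord l), ?_, ?_⟩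
  · rwa [ιMulti_localFrame q ha hq]
  · refine ContDiffOn.sum fun l _ => ?_
    have h := (hV.contDiffOn_busemannIntegral (Module.finBasis ℝ (⋀[ℝ]^(m + 1) V) l)).comp
      (hsmooth.mono inter_subset_left) fun a ha => ha.2
    exact (contDiffOn_const.mul h).smul contDiffOn_const
  · rintro c ⟨hcU, hc, -⟩
    have hw : LinearIndependent ℝ (localFrame q c) := hcU.2
    have hcw := ιMulti_localFrame q hc hcU.1
    refine ContinuousLinearMap.coe_injective
      ((Module.finBasis ℝ (⋀[ℝ]^(m + 1) V)).ext fun l => ?_)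
    have h := hV.busemannForm_ιMulti hw (Module.finBasis ℝ (⋀[ℝ]^(m + 1) V) l)
    rw [hcw] at h
    simp [h, Finsupp.single_apply]

theorem IsMinkowski.busemannForm_tangentVectors {a : ⋀[ℝ]^(m + 1) V}
    (ha : a ∈ unitSphere (density : ⋀[ℝ]^(m + 1) V → ℝ)) {b : ⋀[ℝ]^(m + 1) V}
    (hb : b ∈ tangentVectors (unitSphere (density : ⋀[ℝ]^(m + 1) V → ℝ)) a) :
    busemannForm a b = 0 := by
  obtain ⟨γ, hγ, hS, h0, rfl⟩ := hb
  have ha0 : a ≠ 0 := by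
    rintro rfl
    exact zero_ne_one (density_zero.symm.trans ha.2)
  obtain ⟨q, hq⟩ := exists_toForm_ne_zero (linearIndependent_frame ha.1 ha0)
  rw [ιMulti_frame ha.1] at hq
  have haw := ιMulti_localFrame q ha.1 hq
  have hw : LinearIndependent ℝ (localFrame q a) := ιMulti_ne_zero_iff.1 (by rwa [haw])
  have hUo := isOpen_toForm_ne_zero (V := V) q
  have hcont : ContinuousAt (localFrame q) a :=
    (contDiffOn_localFrame q).continuousOn.continuousAt (hUo.mem_nhds hq)
  have hγ0 : ContinuousAt γ 0 := hγ.continuous.continuousAt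
  -- The calibration inequality along the curve, in local frames, which by continuity stay close to
  -- that of `a`.
  have hev : ∀ᶠ t in nhds (0 : ℝ), busemannForm a (γ t) ≤ 1 := by
    have h1 := hcont.eventually (hV.eventually_busemannIntegral_le hw)
    rw [← h0] at h1
    have h2 : {a | toForm a q ≠ 0} ∈ nhds (γ 0) := by rw [h0]; exact hUo.mem_nhds hq
    filter_upwards [hγ0.eventually h1, hγ0.eventually h2] with t ht1 ht2
    obtain ⟨hmem, hone⟩ := hS t
    have htw := ιMulti_localFrame q hmem ht2
    have htw0 : LinearIndependent ℝ (localFrame q (γ t)) := by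
      rw [← ιMulti_ne_zero_iff, htw]
      rintro h
      rw [h, density_zero] at hone
      exact zero_ne_one hone
    have h3 := hV.busemannForm_ιMulti hw (γ t)
    have h4 := density_ιMulti htw0
    rw [haw] at h3
    rw [htw, hone] at h4
    rw [htw, h0] at ht1
    rw [h3]
    exact (mul_le_mul_of_nonneg_left ht1 (one_div_pos.2 (ballVolume_pos _)).le).trans_eq h4.symm
  have hmax : IsLocalMax (fun t => busemannForm a (γ t)) 0 := by
    filter_upwards [hev] with t ht
    rwa [h0, hV.busemannForm_self ha.1 ha0, ha.2]
  have hd : HasDerivAt γ (deriv γ 0) 0 :=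
    (hγ.differentiable (by simp)).differentiableAt.hasDerivAt
  exact hmax.hasDerivAt_eq_zero ((busemannForm a).hasFDerivAt.comp_hasDerivAt 0 hd)

end Main

end HolmesThompson

/-- On a Minkowski space of dimension `n`, for `1 ≤ k = m + 1 ≤ n`, the Holmes–Thompson function
`φ` is a `k`-density and `a ↦ φ(a) β_a` is a Legendre map for it. -/
theorem mainTheorem3 {V : Type*} [NormedAddCommGroup V] [NormedSpace ℝ V]
    [FiniteDimensional ℝ V] (hV : HolmesThompson.IsMinkowski V) (m : ℕ)
    (hm : m + 1 ≤ Module.finrank ℝ V) :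
    HolmesThompson.IsDensity
      (HolmesThompson.density : ⋀[ℝ]^(m + 1) V → ℝ) ∧
    HolmesThompson.IsLegendreMap
      (HolmesThompson.density : ⋀[ℝ]^(m + 1) V → ℝ)
      (fun a : ⋀[ℝ]^(m + 1) V =>
        HolmesThompson.density a • HolmesThompson.busemannForm a) := by
  refine ⟨⟨?_, ?_, ?_, ?_⟩, ⟨?_, ?_, ?_, ?_⟩⟩
  · intro a ha
    obtain ⟨U, hU, haU, g, hg, hgeq⟩ := hV.smoothOnSubset_busemannForm a ha
    -- Smoothness of the density comes from that of the Busemann form, through `φ(c) = β_c(c)`.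
    refine ⟨U, hU, haU, fun c => g c c, hg.clm_apply contDiffOn_id, fun c hc => ?_⟩
    simp only [hgeq hc]
    exact hV.busemannForm_self hc.2.1 hc.2.2
  · intro a ha
    rcases eq_or_ne a 0 with rfl | h0
    · exact HolmesThompson.density_zero.ge
    · exact (HolmesThompson.density_pos ha h0).le
  · intro a ha
    refine ⟨fun h => ?_, fun h => h ▸ HolmesThompson.density_zero⟩
    by_contra h0
    exact (HolmesThompson.density_pos ha h0).ne' h
  · exact fun a ha t => HolmesThompson.density_smul ha t
  · intro a ha
    obtain ⟨U, hU, haU, g, hg, hgeq⟩ := hV.smoothOnSubset_busemannForm a ha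
    refine ⟨U, hU, haU, fun c => g c c • g c, (hg.clm_apply contDiffOn_id).smul hg,
      fun c hc => ?_⟩
    simp only [hgeq hc]
    rw [hV.busemannForm_self hc.2.1 hc.2.2]
  · exact fun a ha t => hV.density_smul_busemannForm_smul ha t
  · intro a ha
    rcases eq_or_ne a 0 with rfl | h0
    · simp [HolmesThompson.density_zero]
    · change HolmesThompson.density a * HolmesThompson.busemannForm a a = _
      rw [hV.busemannForm_self ha h0, sq]
  · intro a ha b hb
    change HolmesThompson.density a * HolmesThompson.busemannForm a b = 0
    rw [hV.busemannForm_tangentVectors ha hb, mul_zero]
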